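/- Let $B_0>0$ and let $\Psi(x)=\frac{B_0}{4}|x|^2+\Psi_1(x)$, $x\in\mathbb R^2$, with a real-valued $\Psi_1\in L^\infty(\mathbb R^2)$. Identify $\mathbb R^2$ with $\mathbb C$ by $z=x_1+ix_2$, put $\overline\partial=\frac12(\partial_{x_1}+i\partial_{x_2})$, and let $h^+$ be the self-adjoint operator in $L^2(\mathbb R^2)$ associated with the closed quadratic form $$\mathfrak h^+[u]=4\int_{\mathbb R^2}\bigl|\overline\partial(e^{\Psi}u)\bigr|^2e^{-2\Psi}\,dx,\qquad \operatorname{Dom}(\mathfrak h^+)=\{u\in L^2(\mathbb R^2):\mathfrak h^+[u]<\infty\},$$ where $\overline\partial$ is understood in the sense of distributions. Let $P_0$ be the orthogonal projection in $L^2(\mathbb R^2)$ onto $\operatorname{Ker}h^+$. Let $v\in L^1(\mathbb R^2)$ be non-negative, compactly supported and not almost everywhere zero, and for $n=0,1,2,\dots$ put $$M_n(v)=\inf_{p}\int_{\mathbb C}|p(z)|^2v(z)\,dm(z),$$ where $p$ runs over the monic polynomials of degree $n$ with complex coefficients and $dm$ is the Lebesgue measure. Then there is a unique bounded operator $P_0vP_0$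 in $L^2(\mathbb R^2)$ with sesquilinear form $\int_{\mathbb R^2} v\,(P_0w)\,\overline{(P_0u)}\,dx$, $u,w\in L^2(\mathbb R^2)$. It is compact and self-adjoint, its non-zero eigenvalues, counted with multiplicities, form an infinite sequence $s_1\ge s_2\ge\cdots>0$, and $$(n!\,s_{n+1})^{1/n}=\frac{B_0}{2}\,M_n(v)^{1/n}\,(1+o(1)),\qquad n\to\infty.$$ -/

import Mathlib

open MeasureTheory Filter Topology
open scoped ENNReal ContDiff ComplexConjugate Polynomial

noncomputable section

namespace PauliOp

/-- The Hilbert space `L²(ℝ²)`, with `ℝ²` identified with `ℂ` by `z = x₁ + i x₂`. -/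
abbrev L2 : Type := Lp ℂ 2 (volume : Measure ℂ)

/-- The operator `(1/2) (∂_{x₁} + i ∂_{x₂})` on (real) differentiable functions. -/
def dbar (φ : ℂ → ℂ) (z : ℂ) : ℂ :=
  (1 / 2 : ℂ) * (fderiv ℝ φ z 1 + Complex.I * fderiv ℝ φ z Complex.I)

/-- `g` is the derivative `(1/2) (∂_{x₁} + i ∂_{x₂}) F` in the sense of distributions, where both
`F` and `g` are locally integrable functions. -/
structure HasWeakDbar (F g : ℂ → ℂ) : Prop where
  locInt : LocallyIntegrable F volume
  locInt_deriv : LocallyIntegrable g volume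
  integral_eq : ∀ φ : ℂ → ℂ, ContDiff ℝ ∞ φ → HasCompactSupport φ →
    ∫ z, F z * dbar φ z = - ∫ z, g z * φ z

/-- The potential function `Ψ(x) = (B₀ / 4) |x|² + Ψ₁(x)`, with `Ψ₁` real and in `L^∞(ℝ²)`. -/
def potential (B₀ : ℝ) (Ψ₁ : Lp ℝ ∞ (volume : Measure ℂ)) (z : ℂ) : ℝ :=
  B₀ / 4 * ‖z‖ ^ 2 + Ψ₁ z

section Form

variable (B₀ : ℝ) (Ψ₁ : Lp ℝ ∞ (volume : Measure ℂ))

/-- `u` is in the domain of the quadratic form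
`𝔥⁺[u] = 4 ∫ |∂bar (e^Ψ u)|² e^{-2Ψ} dx`, that is `u ∈ L²` and `𝔥⁺[u] < ∞`, and
`g = ∂bar (e^Ψ u)`. -/
structure IsFormDeriv (u : L2) (g : ℂ → ℂ) : Prop where
  weak : HasWeakDbar (fun z => (Real.exp (potential B₀ Ψ₁ z) : ℂ) * u z) g
  memLp : MemLp (fun z => (Real.exp (-potential B₀ Ψ₁ z) : ℂ) * g z) 2 volume

/-- The value at `(φ, u)` of the sesquilinear form which polarizes `𝔥⁺`, in terms of
`gφ = ∂bar (e^Ψ φ)` and `g = ∂bar (e^Ψ u)`; it is conjugate linear in `φ`. -/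
def sesqForm (gφ g : ℂ → ℂ) : ℂ :=
  4 * ∫ z, conj (gφ z) * g z * (Real.exp (-2 * potential B₀ Ψ₁ z) : ℂ)

/-- `u ∈ Dom h⁺` and `h⁺ u = w`, where `h⁺` is the operator in `L²` which corresponds to the
quadratic form `𝔥⁺`: `u` is in the form domain and `𝔥⁺[φ, u] = ⟨φ, w⟩` for every `φ` in the form
domain. -/
def PauliPlusApply (u w : L2) : Prop :=
  ∃ g, IsFormDeriv B₀ Ψ₁ u g ∧
    ∀ (φ : L2) (gφ : ℂ → ℂ), IsFormDeriv B₀ Ψ₁ φ gφ →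
      sesqForm B₀ Ψ₁ gφ g = inner ℂ φ w

variable {B₀ Ψ₁}

theorem exists_bound : ∃ C : ℝ, ∀ᵐ z : ℂ, ‖(Real.exp (Ψ₁ z) : ℂ)‖ ≤ C := by
  refine ⟨Real.exp (eLpNormEssSup Ψ₁ volume).toReal, ?_⟩
  have hfin : eLpNormEssSup Ψ₁ volume ≠ ⊤ := by
    have := (Lp.memLp Ψ₁).eLpNorm_ne_top
    rwa [eLpNorm_exponent_top] at this
  filter_upwards [ae_le_eLpNormEssSup (f := Ψ₁) (μ := volume)] with z hz
  rw [Complex.norm_real, Real.norm_eq_abs, Real.abs_exp]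
  refine Real.exp_le_exp.2 ((le_abs_self _).trans ?_)
  have := ENNReal.toReal_mono hfin hz
  simpa using this

theorem aestronglyMeasurable_exp :
    AEStronglyMeasurable (fun z : ℂ => (Real.exp (Ψ₁ z) : ℂ)) volume :=
  (Complex.continuous_ofReal.comp Real.continuous_exp).comp_aestronglyMeasurable
    (Lp.aestronglyMeasurable Ψ₁)

theorem exp_mul_eq (f : ℂ → ℂ) (z : ℂ) :
    (Real.exp (potential B₀ Ψ₁ z) : ℂ) * f z =
      (Real.exp (Ψ₁ z) : ℂ) * ((Real.exp (B₀ / 4 * ‖z‖ ^ 2) : ℂ) * f z) := by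
  simp only [potential, Real.exp_add]
  push_cast
  ring

/-- `e^Ψ ψ` is in `L²` for continuous compactly supported `ψ`. -/
theorem memLp_exp_mul {ψ : ℂ → ℂ} (hψ : Continuous ψ) (hs : HasCompactSupport ψ) :
    MemLp (fun z => (Real.exp (potential B₀ Ψ₁ z) : ℂ) * ψ z) 2 volume := by
  have hc : Continuous fun z : ℂ => (Real.exp (B₀ / 4 * ‖z‖ ^ 2) : ℂ) * ψ z := by fun_prop
  have h1 : MemLp (fun z : ℂ => (Real.exp (B₀ / 4 * ‖z‖ ^ 2) : ℂ) * ψ z) 2 volume :=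
    hc.memLp_of_hasCompactSupport hs.mul_left
  obtain ⟨C, hC⟩ := exists_bound (Ψ₁ := Ψ₁)
  have h2 : MemLp (fun z : ℂ => (Real.exp (Ψ₁ z) : ℂ)) ∞ volume :=
    memLp_top_of_bound aestronglyMeasurable_exp C hC
  have h3 := h1.mul (r := 2) h2
  exact h3.ae_eq (Eventually.of_forall fun z => (exp_mul_eq ψ z).symm)

theorem locallyIntegrable_exp_mul (u : L2) :
    LocallyIntegrable (fun z => (Real.exp (potential B₀ Ψ₁ z) : ℂ) * u z) volume := by
  have hu : LocallyIntegrable u volume := (Lp.memLp u).locallyIntegrable (by norm_num)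
  rw [locallyIntegrable_iff] at hu ⊢
  intro K hK
  have hc : Continuous fun z : ℂ => (Real.exp (B₀ / 4 * ‖z‖ ^ 2) : ℂ) := by fun_prop
  have h1 := (hu K hK).continuousOn_mul hc.continuousOn hK
  obtain ⟨C, hC⟩ := exists_bound (Ψ₁ := Ψ₁)
  have h2 := Integrable.bdd_mul h1 (aestronglyMeasurable_exp (Ψ₁ := Ψ₁)).restrict
    (ae_restrict_of_ae hC)
  exact h2.congr (Eventually.of_forall fun z => (exp_mul_eq u z).symm)

theorem continuous_dbar {φ : ℂ → ℂ} (hφ : ContDiff ℝ ∞ φ) : Continuous (dbar φ) := by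
  have h : Continuous (fderiv ℝ φ) := hφ.continuous_fderiv (by simp)
  unfold dbar
  fun_prop

theorem hasCompactSupport_dbar {φ : ℂ → ℂ} (hs : HasCompactSupport φ) :
    HasCompactSupport (dbar φ) := by
  refine (hs.fderiv ℝ).mono fun z hz => ?_
  contrapose hz
  have h0 : fderiv ℝ φ z = 0 := by simpa using hz
  simp [dbar, h0]

/-- `h⁺ u = 0` if and only if `∂bar (e^Ψ u) = 0` in the sense of distributions. -/
theorem pauliPlusApply_zero_iff (u : L2) :
    PauliPlusApply B₀ Ψ₁ u 0 ↔
      ∀ φ : ℂ → ℂ, ContDiff ℝ ∞ φ → HasCompactSupport φ →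
        ∫ z, (Real.exp (potential B₀ Ψ₁ z) : ℂ) * u z * dbar φ z = 0 := by
  constructor
  · rintro ⟨g, hg, h⟩ φ hφ hs
    have h0 := h u g hg
    rw [inner_zero_right, sesqForm, mul_eq_zero, or_iff_right (by norm_num)] at h0
    have hpt : ∀ z, conj (g z) * g z * (Real.exp (-2 * potential B₀ Ψ₁ z) : ℂ) =
        ((‖(Real.exp (-potential B₀ Ψ₁ z) : ℂ) * g z‖ ^ 2 : ℝ) : ℂ) := by
      intro z
      rw [norm_mul, Complex.norm_real, Real.norm_eq_abs, Real.abs_exp, mul_pow,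
        ← Real.exp_nat_mul, Complex.ofReal_mul, Complex.conj_mul', mul_comm]
      push_cast
      ring_nf
    simp_rw [hpt] at h0
    rw [integral_complex_ofReal, Complex.ofReal_eq_zero, integral_eq_zero_iff_of_nonneg
      (fun z => by positivity) ((memLp_two_iff_integrable_sq_norm hg.memLp.1).1 hg.memLp)] at h0
    have hg0 : g =ᵐ[volume] 0 := by
      filter_upwards [h0] with z hz
      have : ‖(Real.exp (-potential B₀ Ψ₁ z) : ℂ) * g z‖ = 0 := by simpa using hz
      rw [norm_mul, mul_eq_zero, norm_eq_zero, norm_eq_zero] at this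
      rcases this with h | h
      · exact absurd h (by simpa using (Real.exp_pos _).ne')
      · exact h
    rw [hg.weak.integral_eq φ hφ hs, neg_eq_zero]
    refine integral_eq_zero_of_ae ?_
    filter_upwards [hg0] with z hz
    simp [hz]
  · intro h
    refine ⟨0, ⟨⟨locallyIntegrable_exp_mul u, locallyIntegrable_zero, fun φ hφ hs => ?_⟩, ?_⟩, ?_⟩
    · rw [h φ hφ hs]
      simp
    · simp
    · intro φ gφ _
      simp [sesqForm]

/-- `∫ e^Ψ u (∂bar φ)` as an inner product in `L²`. -/
theorem exists_inner_eq {φ : ℂ → ℂ} (hφ : ContDiff ℝ ∞ φ) (hs : HasCompactSupport φ) :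
    ∃ k : L2, ∀ u : L2,
      ∫ z, (Real.exp (potential B₀ Ψ₁ z) : ℂ) * u z * dbar φ z = inner ℂ k u := by
  have hc : Continuous fun z => conj (dbar φ z) :=
    Complex.continuous_conj.comp (continuous_dbar hφ)
  have hcs : HasCompactSupport fun z => conj (dbar φ z) :=
    (hasCompactSupport_dbar hs).comp_left (g := conj) (map_zero _)
  have hm := memLp_exp_mul (B₀ := B₀) (Ψ₁ := Ψ₁) hc hcs
  refine ⟨hm.toLp _, fun u => ?_⟩
  rw [L2.inner_def]
  refine integral_congr_ae ?_
  filter_upwards [hm.coeFn_toLp] with z hz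
  rw [hz, RCLike.inner_apply, map_mul, Complex.conj_conj, Complex.conj_ofReal]
  ring

variable (B₀ Ψ₁)

/-- `Ker h⁺`. -/
def kerPauliPlus : Submodule ℂ L2 where
  carrier := {u | PauliPlusApply B₀ Ψ₁ u 0}
  zero_mem' := by
    rw [Set.mem_ofPred_eq, pauliPlusApply_zero_iff]
    intro φ hφ hs
    obtain ⟨k, hk⟩ := exists_inner_eq (B₀ := B₀) (Ψ₁ := Ψ₁) hφ hs
    rw [hk, inner_zero_right]
  add_mem' := by
    intro u w hu hw
    rw [Set.mem_ofPred_eq, pauliPlusApply_zero_iff] at hu hw ⊢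
    intro φ hφ hs
    obtain ⟨k, hk⟩ := exists_inner_eq (B₀ := B₀) (Ψ₁ := Ψ₁) hφ hs
    rw [hk, inner_add_right, ← hk, ← hk, hu φ hφ hs, hw φ hφ hs, add_zero]
  smul_mem' := by
    intro c u hu
    rw [Set.mem_ofPred_eq, pauliPlusApply_zero_iff] at hu ⊢
    intro φ hφ hs
    obtain ⟨k, hk⟩ := exists_inner_eq (B₀ := B₀) (Ψ₁ := Ψ₁) hφ hs
    rw [hk, inner_smul_right, ← hk, hu φ hφ hs, mul_zero]

theorem isClosed_kerPauliPlus : IsClosed (kerPauliPlus B₀ Ψ₁ : Set L2) := by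
  have h : (kerPauliPlus B₀ Ψ₁ : Set L2) =
      ⋂ (φ : ℂ → ℂ) (_ : ContDiff ℝ ∞ φ) (_ : HasCompactSupport φ),
        {u : L2 | ∫ z, (Real.exp (potential B₀ Ψ₁ z) : ℂ) * u z * dbar φ z = 0} := by
    ext u
    simp only [Set.mem_iInter, Set.mem_ofPred_eq]
    exact pauliPlusApply_zero_iff u
  rw [h]
  refine isClosed_iInter fun φ => isClosed_iInter fun hφ => isClosed_iInter fun hs => ?_
  obtain ⟨k, hk⟩ := exists_inner_eq (B₀ := B₀) (Ψ₁ := Ψ₁) hφ hs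
  simp_rw [hk]
  exact isClosed_eq (by fun_prop) continuous_const

instance : CompleteSpace (kerPauliPlus B₀ Ψ₁) :=
  (isClosed_kerPauliPlus B₀ Ψ₁).completeSpace_coe

/-- `P₀`, the orthogonal projection in `L²` onto `Ker h⁺`. -/
def P0 : L2 →L[ℂ] L2 := (kerPauliPlus B₀ Ψ₁).starProjection

/-- `T` is the bounded operator `P₀ v P₀` in `L²`, that is the operator of the sesquilinear form
`(u, w) ↦ ∫ v (P₀ w) conj (P₀ u) dx` (for `v ∈ L¹`, multiplication by `v` need not map `Ker h⁺`
into `L²`, and the product `P₀ v P₀` is understood through its form). -/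
def IsP0vP0 (v : ℂ → ℝ) (T : L2 →L[ℂ] L2) : Prop :=
  ∀ u w : L2,
    Integrable (fun z => (v z : ℂ) * (conj (P0 B₀ Ψ₁ u z) * P0 B₀ Ψ₁ w z)) volume ∧
    inner ℂ u (T w) = ∫ z, (v z : ℂ) * (conj (P0 B₀ Ψ₁ u z) * P0 B₀ Ψ₁ w z)

end Form

/-- `s 0 ≥ s 1 ≥ s 2 ≥ ⋯ > 0` is the list of all non-zero eigenvalues of `T`, each repeated
according to its multiplicity. -/
structure IsEigenvalueSeq (T : L2 →L[ℂ] L2) (s : ℕ → ℝ) : Prop where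
  antitone : Antitone s
  pos : ∀ n, 0 < s n
  finite_mult : ∀ μ : ℂ, μ ≠ 0 →
    FiniteDimensional ℂ (Module.End.eigenspace (T : L2 →ₗ[ℂ] L2) μ)
  card_eq : ∀ μ : ℂ, μ ≠ 0 →
    {n : ℕ | (s n : ℂ) = μ}.encard =
      (Module.finrank ℂ (Module.End.eigenspace (T : L2 →ₗ[ℂ] L2) μ) : ℕ∞)

/-- `M_n(v)`, the infimum of `∫ |p|² v dm` over the monic polynomials `p` of degree `n`. -/
def M (n : ℕ) (v : ℂ → ℝ) : ℝ :=
  sInf {r : ℝ | ∃ p : ℂ[X], p.Monic ∧ p.natDegree = n ∧ r = ∫ z, ‖p.eval z‖ ^ 2 * v z}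

end PauliOp

end

/-!
The elements of `Ker h⁺` are the functions `e^{-Ψ} f` in `L²` with `f` entire; this is Weyl's lemma
for the Cauchy-Riemann operator, `exists_entire_of_integral_dbar`. As `Ψ₁` is bounded, up to constant
factors the kernel is the Fock space of entire functions with the weight `e^{-B₀|z|²/2}`, and
`P₀ v P₀ = J* J` with `J = √v P₀`, so its quadratic form is comparable to `∫ |f|² v`. The eigenvalues
are estimated by the min-max principle. Let `v` be supported in the disc of radius `R`.

Upper bound. A monic polynomial of degree `n` whose roots of modulus above `2R` are moved to the
origin does not increase on the disc (`exists_moved_roots`), so only polynomials `p` with all their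
roots in the disc of radius `2R` matter. Divisibility of `f` by `p` is a condition of codimension at
most `n` (`codimLE_divisibleBy`). If `f = p g`, the maximum principle bounds `g` on the disc by
`sup_{|z| = ρ} |f| / (ρ - 2R)^n`, while `|f|²` grows at most like `e^{B₀ (|z| + 1)² / 2}`. Hence
`s n ≤ C e^{B₀ (ρ + 1)² / 2} (ρ - 2R)^{-2n} M_n(v)` for every `ρ > 2R`, and the choice
`ρ² ≈ 2n / B₀` together with Stirling's formula gives `n! s n ≤ (B₀ / 2)^n M_n(v) e^{o(n)}`. The same
bound with `p = z^n` shows that `J` is small on subspaces of finite codimension, hence compact.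

Lower bound. On polynomials `p` of degree at most `n` one has
`M_n(v) ∫ |p|² e^{-B₀|z|²/2} ≤ I_n ∫ |p|² v` with `I_n = ∫ (|z| + 2R)^{2n} e^{-B₀|z|²/2}`
(`IsWeight.M_mul_integral_le`): a root `a` with `|a| > 2R` contributes a factor of size at least
`(|a| / 2R) |z|` on the disc and at most `(|a| / 2R) (|z| + 2R)` in the plane, and missing degrees are
filled up with powers of `z`. Since `x^n ≤ n! t^{-n} e^{t x}`, one gets `I_n ≤ C_t n! t^{-n}` for
every `t < B₀ / 2`, so that `n! s n ≥ c_t t^n M_n(v)`.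
-/

namespace PauliOp

/-! ### Entire functions: mean values and Weyl's lemma -/

open scoped Convolution
open ContinuousLinearMap (lsmul)

theorem exists_radial_bump : ∃ η : ℂ → ℝ, ContDiff ℝ ∞ η ∧ HasCompactSupport η ∧
    (∀ z, 1 ≤ ‖z‖ → η z = 0) ∧ (∀ z w, ‖z‖ = ‖w‖ → η z = η w) ∧ ∫ z, η z = 1 := by
  let b : ContDiffBump (0 : ℝ) := ⟨1 / 2, 1, by norm_num, by norm_num⟩
  let f : ℂ → ℝ := fun z => b (‖z‖ ^ 2)
  have hf : ContDiff ℝ ∞ f := b.contDiff.comp (contDiff_norm_sq ℝ)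
  have h0 : ∀ z, 1 ≤ ‖z‖ → f z = 0 := fun z hz => b.zero_of_le_dist (by
    rw [dist_zero_right, Real.norm_eq_abs, abs_of_nonneg (by positivity)]
    exact one_le_pow₀ hz)
  have hs : HasCompactSupport f :=
    HasCompactSupport.intro (isCompact_closedBall (0 : ℂ) 1) fun z hz => h0 z (by
      simp only [Metric.mem_closedBall, dist_zero_right, not_le] at hz
      exact hz.le)
  have hpos : 0 < ∫ z, f z := by
    refine hf.continuous.integral_pos_of_hasCompactSupport_nonneg_nonzero hs
      (fun z => b.nonneg) (x := 0) ?_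
    have : f 0 = 1 := b.one_of_mem_closedBall (by simp [b])
    rw [this]
    exact one_ne_zero
  refine ⟨fun z => (∫ w, f w)⁻¹ * f z, contDiff_const.mul hf, hs.mul_left, fun z hz => ?_,
    fun z w hzw => ?_, ?_⟩
  · simp [h0 z hz]
  · simp only [f, hzw]
  · rw [integral_const_mul, inv_mul_cancel₀ hpos.ne']

/-- Mean value property over a disc with a radial weight: rotations preserve the weighted integral,
and the mean over all rotations is a mean over circles. -/
theorem integral_radial_smul {η : ℂ → ℝ} (hη : Continuous η) (hs : HasCompactSupport η)
    (hrad : ∀ z w, ‖z‖ = ‖w‖ → η z = η w) (h1 : ∫ z, η z = 1) {f : ℂ → ℂ}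
    (hf : Differentiable ℂ f) (z : ℂ) : ∫ w, η w • f (z - w) = f z := by
  have hfc := hf.continuous
  have hrot : ∀ θ : ℝ, ∫ w, η w • f (z - circleMap 0 1 θ * w) = ∫ w, η w • f (z - w) := by
    intro θ
    have hmp := (rotation (Circle.exp θ)).measurePreserving
    rw [← hmp.integral_comp (rotation (Circle.exp θ)).toHomeomorph.measurableEmbedding
      (fun w => η w • f (z - w))]
    refine integral_congr_ae (Eventually.of_forall fun w => ?_)
    have : (rotation (Circle.exp θ)) w = circleMap 0 1 θ * w := by
      simp [rotation_apply, circleMap]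
    simp only
    rw [hrad (rotation (Circle.exp θ) w) w (by simp), this]
  have hmean : ∀ w : ℂ, ∫ θ in (0)..2 * Real.pi, η w • f (z - circleMap 0 1 θ * w) =
      (2 * Real.pi) • (η w • f z) := by
    intro w
    have hd : Differentiable ℂ fun ζ : ℂ => f (z - ζ * w) := by fun_prop
    have := DiffContOnCl.circleAverage (f := fun ζ : ℂ => f (z - ζ * w)) (R := 1) (c := 0)
      hd.diffContOnCl
    rw [Real.circleAverage] at this
    simp only [zero_mul, sub_zero] at this
    rw [intervalIntegral.integral_smul, ← this, smul_smul, smul_smul]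
    congr 1
    field_simp
  have : IsFiniteMeasure ((volume : Measure ℝ).restrict (Set.uIoc 0 (2 * Real.pi))) := by
    rw [Set.uIoc_of_le (by positivity)]
    infer_instance
  have hint : Integrable (Function.uncurry fun (θ : ℝ) (w : ℂ) =>
      η w • f (z - circleMap 0 1 θ * w))
      ((volume.restrict (Set.uIoc 0 (2 * Real.pi))).prod volume) := by
    obtain ⟨r, hr⟩ := hs.isCompact.isBounded.subset_closedBall 0
    obtain ⟨C, hC⟩ := (isCompact_closedBall z r).exists_bound_of_continuousOn hfc.continuousOn
    have hηi : Integrable (fun w => C * ‖η w‖) volume :=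
      ((hη.integrable_of_hasCompactSupport hs).norm).const_mul C
    refine Integrable.mono' (hηi.comp_snd _) ?_ (Eventually.of_forall ?_)
    · refine Continuous.aestronglyMeasurable ?_
      simp only [Function.uncurry_def]
      fun_prop
    · rintro ⟨θ, w⟩
      simp only [Function.uncurry_apply_pair, norm_smul]
      by_cases hw : η w = 0
      · simp [hw]
      · rw [mul_comm]
        refine mul_le_mul_of_nonneg_right (hC _ ?_) (norm_nonneg _)
        have := hr (subset_tsupport _ hw)
        simpa using this
  have hswap := intervalIntegral_integral_swap hint
  simp only [hrot, hmean, intervalIntegral.integral_const, sub_zero] at hswap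
  rw [integral_smul, integral_smul_const, h1, one_smul] at hswap
  exact smul_right_injective _ (by positivity) hswap

/-- Convolutions with two kernels commute. -/
theorem convolution_left_comm {η φ : ℂ → ℝ} (hη : Continuous η) (hηs : HasCompactSupport η)
    (hφ : Continuous φ) (hφs : HasCompactSupport φ) {F : ℂ → ℂ} (hF : LocallyIntegrable F volume) :
    (η ⋆[lsmul ℝ ℝ, volume] (φ ⋆[lsmul ℝ ℝ, volume] F : ℂ → ℂ) : ℂ → ℂ) =
      (φ ⋆[lsmul ℝ ℝ, volume] (η ⋆[lsmul ℝ ℝ, volume] F : ℂ → ℂ) : ℂ → ℂ) := by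
  have hFn : LocallyIntegrable (fun z => ‖F z‖) volume := fun x => by
    obtain ⟨s, hs, h⟩ := hF x
    exact ⟨s, hs, h.norm⟩
  have key : ∀ {η φ : ℂ → ℝ}, Continuous η → HasCompactSupport η → Continuous φ →
      HasCompactSupport φ → ∀ x,
      ((η ⋆[ContinuousLinearMap.mul ℝ ℝ, volume] φ : ℂ → ℝ) ⋆[lsmul ℝ ℝ, volume] F : ℂ → ℂ) x =
      (η ⋆[lsmul ℝ ℝ, volume] (φ ⋆[lsmul ℝ ℝ, volume] F : ℂ → ℂ) : ℂ → ℂ) x := by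
    intro η φ hη hηs hφ hφs x
    refine convolution_assoc (ContinuousLinearMap.mul ℝ ℝ) (lsmul ℝ ℝ) (lsmul ℝ ℝ) (lsmul ℝ ℝ)
      (fun a b c => by simp [mul_assoc]) hη.aestronglyMeasurable hφ.aestronglyMeasurable
      hF.aestronglyMeasurable (Eventually.of_forall fun y => ?_) (Eventually.of_forall fun y => ?_)
      ?_
    · exact hηs.convolutionExists_left _ hη hφ.locallyIntegrable y
    · exact hφs.norm.convolutionExists_left _ hφ.norm hFn y
    · refine hηs.norm.convolutionExists_left _ hη.norm ?_ x
      exact (hφs.norm.continuous_convolution_left _ hφ.norm hFn).locallyIntegrable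
  have hcomm : (η ⋆[ContinuousLinearMap.mul ℝ ℝ, volume] φ : ℂ → ℝ) =
      (φ ⋆[ContinuousLinearMap.mul ℝ ℝ, volume] η : ℂ → ℝ) := by
    rw [← convolution_flip]
    congr 1
    ext
    simp
  funext x
  rw [← key hη hηs hφ hφs, ← key hφ hφs hη hηs, hcomm]

/-- A mollification of a distributional solution of the Cauchy-Riemann equation is entire. -/
theorem differentiable_convolution {F : ℂ → ℂ} (hF : LocallyIntegrable F volume)
    (h0 : ∀ φ : ℂ → ℂ, ContDiff ℝ ∞ φ → HasCompactSupport φ → ∫ z, F z * dbar φ z = 0)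
    {η : ℂ → ℝ} (hη : ContDiff ℝ ∞ η) (hs : HasCompactSupport η) :
    Differentiable ℂ (η ⋆[lsmul ℝ ℝ, volume] F : ℂ → ℂ) := by
  intro x
  have hη1 : ContDiff ℝ 1 η := hη.of_le (by exact_mod_cast le_top)
  have hd := hs.hasFDerivAt_convolution_left (lsmul ℝ ℝ) hη1 hF x
  rw [differentiableAt_complex_iff_differentiableAt_real]
  refine ⟨hd.differentiableAt, ?_⟩
  have hcf : Continuous (fderiv ℝ η) := hη1.continuous_fderiv (by simp)
  have hex : ConvolutionExistsAt (fderiv ℝ η) F x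
      (ContinuousLinearMap.precompL ℂ (lsmul ℝ ℝ : ℝ →L[ℝ] ℂ →L[ℝ] ℂ)) volume :=
    (hs.fderiv ℝ).convolutionExists_left _ hcf hF x
  have hex' := hex.integrable_swap
  have happ : ∀ v : ℂ, fderiv ℝ (η ⋆[lsmul ℝ ℝ, volume] F : ℂ → ℂ) x v =
      ∫ t, ((fderiv ℝ η (x - t) v : ℝ) : ℂ) * F t := by
    intro v
    rw [hd.fderiv, convolution_eq_swap, ContinuousLinearMap.integral_apply hex']
    simp [ContinuousLinearMap.precompL_apply]
  have hint : ∀ v : ℂ, Integrable fun t => ((fderiv ℝ η (x - t) v : ℝ) : ℂ) * F t := by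
    intro v
    have := hex'.apply_continuousLinearMap v
    simpa [ContinuousLinearMap.precompL_apply] using this
  let φ : ℂ → ℂ := fun t => (η (x - t) : ℂ)
  have hφ : ContDiff ℝ ∞ φ :=
    Complex.ofRealCLM.contDiff.comp (hη.comp (contDiff_const.sub contDiff_id))
  have hφs : HasCompactSupport φ := by
    have h1 : HasCompactSupport fun t => η (x - t) :=
      hs.comp_homeomorph (Homeomorph.subLeft x)
    exact h1.comp_left (g := fun r : ℝ => (r : ℂ)) (by simp)
  have hφd : ∀ t v, fderiv ℝ φ t v = -((fderiv ℝ η (x - t) v : ℝ) : ℂ) := by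
    intro t v
    have h1 : HasFDerivAt (fun t => η (x - t)) _ t :=
      ((hη1.differentiable (by simp)) (x - t)).hasFDerivAt.comp t
        ((hasFDerivAt_id t).const_sub x)
    have h2 := (Complex.ofRealCLM.hasFDerivAt (x := η (x - t))).comp t h1
    have h3 : fderiv ℝ φ t = _ := h2.fderiv
    rw [h3]
    simp
  have h := h0 φ hφ hφs
  have heq : ∀ t, F t * dbar φ t = -(1 / 2 : ℂ) * (((fderiv ℝ η (x - t) 1 : ℝ) : ℂ) * F t) -
      Complex.I / 2 * (((fderiv ℝ η (x - t) Complex.I : ℝ) : ℂ) * F t) := by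
    intro t
    rw [dbar, hφd, hφd]
    ring
  simp_rw [heq] at h
  rw [integral_sub ((hint 1).const_mul _) ((hint Complex.I).const_mul _), integral_const_mul,
    integral_const_mul, ← happ, ← happ] at h
  rw [smul_eq_mul]
  linear_combination (2 * Complex.I) * h +
    (fderiv ℝ (η ⋆[lsmul ℝ ℝ, volume] F : ℂ → ℂ) x Complex.I) * Complex.I_sq

/-- Weyl's lemma for the Cauchy-Riemann operator. -/
theorem exists_entire_of_integral_dbar {F : ℂ → ℂ} (hF : LocallyIntegrable F volume)
    (h0 : ∀ φ : ℂ → ℂ, ContDiff ℝ ∞ φ → HasCompactSupport φ → ∫ z, F z * dbar φ z = 0) :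
    ∃ f : ℂ → ℂ, Differentiable ℂ f ∧ F =ᵐ[volume] f := by
  obtain ⟨η, hη, hs, -, hrad, h1⟩ := exists_radial_bump
  refine ⟨η ⋆[lsmul ℝ ℝ, volume] F, differentiable_convolution hF h0 hη hs, ?_⟩
  let φ : ℕ → ContDiffBump (0 : ℂ) := fun n =>
    ⟨1 / (n + 1), 2 * (1 / (n + 1)), by positivity, by
      have : (0 : ℝ) < 1 / (n + 1) := by positivity
      linarith⟩
  have hφ : Tendsto (fun n => (φ n).rOut) atTop (𝓝 0) := by
    have := (tendsto_one_div_add_atTop_nhds_zero_nat (𝕜 := ℝ)).const_mul 2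
    rwa [mul_zero] at this
  have hae := ContDiffBump.ae_convolution_tendsto_right_of_locallyIntegrable (μ := volume) hφ
    (K := 2) (Eventually.of_forall fun n => le_rfl) hF
  filter_upwards [hae] with x hx
  have hsm : ∀ n, ContDiff ℝ ∞ ((φ n).normed volume) := fun n => (φ n).contDiff_normed
  have hcs : ∀ n, HasCompactSupport ((φ n).normed volume) := fun n =>
    (φ n).hasCompactSupport_normed
  have heq : ∀ n, ((φ n).normed volume ⋆[lsmul ℝ ℝ, volume] F : ℂ → ℂ) x =
      ((φ n).normed volume ⋆[lsmul ℝ ℝ, volume] (η ⋆[lsmul ℝ ℝ, volume] F : ℂ → ℂ) : ℂ → ℂ) x := by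
    intro n
    rw [← convolution_left_comm hη.continuous hs (hsm n).continuous (hcs n) hF]
    exact (integral_radial_smul hη.continuous hs hrad h1
      (differentiable_convolution hF h0 (hsm n) (hcs n)) x).symm
  simp_rw [heq] at hx
  exact tendsto_nhds_unique hx (ContDiffBump.convolution_tendsto_right_of_continuous hφ
    (differentiable_convolution hF h0 hη hs).continuous x)

/-- Point values of an entire function are controlled by its `L²` norm on the unit disc. -/
theorem exists_sq_norm_le_integral_ball : ∃ C : ℝ, 0 < C ∧ ∀ f : ℂ → ℂ, Differentiable ℂ f →
    ∀ z, ‖f z‖ ^ 2 ≤ C * ∫ w in Metric.ball z 1, ‖f w‖ ^ 2 := by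
  obtain ⟨η, hη, hs, hout, hrad, h1⟩ := exists_radial_bump
  obtain ⟨D, hD⟩ := hη.continuous.bounded_above_of_compact_support hs
  refine ⟨D ^ 2 * Real.pi + 1, by positivity, fun f hf z => ?_⟩
  have hD0 : 0 ≤ D := (norm_nonneg _).trans (hD 0)
  have hfc := hf.continuous
  have hfi : IntegrableOn (fun w => ‖f w‖ ^ 2) (Metric.ball z 1) :=
    ((by fun_prop : Continuous fun w => ‖f w‖ ^ 2).locallyIntegrable.integrableOn_isCompact
      (isCompact_closedBall z 1)).mono_set Metric.ball_subset_closedBall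
  have hfi1 : IntegrableOn (fun w => ‖f w‖) (Metric.ball z 1) :=
    ((by fun_prop : Continuous fun w => ‖f w‖).locallyIntegrable.integrableOn_isCompact
      (isCompact_closedBall z 1)).mono_set Metric.ball_subset_closedBall
  have hA : ‖f z‖ ≤ D * ∫ w in Metric.ball z 1, ‖f w‖ := by
    have hmv := integral_radial_smul hη.continuous hs hrad h1 hf z
    rw [← integral_sub_left_eq_self (fun w => η w • f (z - w)) volume z] at hmv
    simp only [sub_sub_cancel] at hmv
    have hset : ∫ w, η (z - w) • f w = ∫ w in Metric.ball z 1, η (z - w) • f w := by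
      symm
      refine setIntegral_eq_integral_of_forall_compl_eq_zero fun w hw => ?_
      rw [hout, zero_smul]
      rw [Metric.mem_ball, not_lt, dist_eq_norm, norm_sub_rev] at hw
      exact hw
    rw [← hmv, hset, ← integral_const_mul]
    refine norm_integral_le_of_norm_le (hfi1.const_mul D) (Eventually.of_forall fun w => ?_)
    rw [norm_smul]
    exact mul_le_mul_of_nonneg_right (hD _) (norm_nonneg _)
  -- Cauchy-Schwarz against the constant function on the disc, whose area is `π`.
  have hvol : volume.real (Metric.ball z 1) = Real.pi := by
    simp [Measure.real, Complex.volume_ball]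
  have hCS : (∫ w in Metric.ball z 1, ‖f w‖) ^ 2 ≤
      Real.pi * ∫ w in Metric.ball z 1, ‖f w‖ ^ 2 := by
    set a := ∫ w in Metric.ball z 1, ‖f w‖ with ha
    have hnn : 0 ≤ ∫ w in Metric.ball z 1, (‖f w‖ - a / Real.pi) ^ 2 :=
      integral_nonneg fun w => by positivity
    have hexp : ∀ w, (‖f w‖ - a / Real.pi) ^ 2 =
        ‖f w‖ ^ 2 - 2 * (a / Real.pi) * ‖f w‖ + (a / Real.pi) ^ 2 := fun w => by ring
    simp_rw [hexp] at hnn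
    have hci : IntegrableOn (fun _ : ℂ => (a / Real.pi) ^ 2) (Metric.ball z 1) :=
      integrableOn_const (by simp [Complex.volume_ball])
    have hsub : IntegrableOn (fun w => ‖f w‖ ^ 2 - 2 * (a / Real.pi) * ‖f w‖)
      (Metric.ball z 1) := hfi.sub (hfi1.const_mul _)
    rw [integral_add hsub hci, integral_sub hfi (hfi1.const_mul _),
      integral_const_mul, ← ha, setIntegral_const, hvol, smul_eq_mul] at hnn
    have hpi := Real.pi_pos
    have : 0 ≤ Real.pi * (∫ w in Metric.ball z 1, ‖f w‖ ^ 2) - a ^ 2 := by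
      have := mul_nonneg hpi.le hnn
      have e : Real.pi * ((∫ w in Metric.ball z 1, ‖f w‖ ^ 2) - 2 * (a / Real.pi) * a +
        Real.pi * (a / Real.pi) ^ 2) = Real.pi * (∫ w in Metric.ball z 1, ‖f w‖ ^ 2) - a ^ 2 := by
        field_simp
        ring
      rwa [e] at this
    linarith
  have hnn : 0 ≤ ∫ w in Metric.ball z 1, ‖f w‖ ^ 2 := integral_nonneg fun w => by positivity
  calc ‖f z‖ ^ 2 ≤ (D * ∫ w in Metric.ball z 1, ‖f w‖) ^ 2 := by gcongr
    _ = D ^ 2 * (∫ w in Metric.ball z 1, ‖f w‖) ^ 2 := by ring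
    _ ≤ D ^ 2 * (Real.pi * ∫ w in Metric.ball z 1, ‖f w‖ ^ 2) := by gcongr
    _ ≤ _ := by nlinarith

/-! ### Polynomials and division of entire functions -/

open Polynomial in
/-- The monic polynomial with a prescribed multiset of roots. -/
noncomputable def rootPoly (S : Multiset ℂ) : ℂ[X] := (S.map fun a => X - C a).prod

theorem rootPoly_monic (S : Multiset ℂ) : (rootPoly S).Monic :=
  Polynomial.monic_multiset_prod_of_monic _ _ fun a _ => Polynomial.monic_X_sub_C a

theorem natDegree_rootPoly (S : Multiset ℂ) : (rootPoly S).natDegree = S.card :=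
  Polynomial.natDegree_multiset_prod_X_sub_C_eq_card S

theorem rootPoly_cons (a : ℂ) (S : Multiset ℂ) (z : ℂ) :
    (rootPoly (a ::ₘ S)).eval z = (z - a) * (rootPoly S).eval z := by
  simp [rootPoly]

theorem eval_rootPoly_zero (z : ℂ) : (rootPoly 0).eval z = 1 := by
  simp [rootPoly]

theorem eq_C_mul_rootPoly (p : ℂ[X]) :
    p = Polynomial.C p.leadingCoeff * rootPoly p.roots :=
  (IsAlgClosed.splits p).eq_prod_roots

theorem card_roots_eq (p : ℂ[X]) : p.roots.card = p.natDegree :=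
  (IsAlgClosed.splits p).natDegree_eq_card_roots.symm

/-- Moving the roots `a` with `|a| > 2R` to the origin divides the polynomial by at least
`A = ∏ |a| / (2R)` on the disc of radius `R`; up to this same factor `A`, the original polynomial is
bounded by `(|z| + 2R)^n` in the whole plane. -/
theorem exists_moved_roots {R : ℝ} (hR : 0 < R) (S : Multiset ℂ) :
    ∃ S' : Multiset ℂ, S'.card = S.card ∧ (∀ a ∈ S', ‖a‖ ≤ 2 * R) ∧ ∃ A : ℝ, 1 ≤ A ∧
      (∀ z, ‖z‖ ≤ R → A * ‖(rootPoly S').eval z‖ ≤ ‖(rootPoly S).eval z‖) ∧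
      ∀ z, ‖(rootPoly S).eval z‖ ≤ A * (‖z‖ + 2 * R) ^ S.card := by
  induction S using Multiset.induction_on with
  | empty =>
    refine ⟨0, rfl, by simp, 1, le_rfl, ?_, ?_⟩ <;> simp [eval_rootPoly_zero]
  | cons a S ih =>
    obtain ⟨S', hc, hS', A, hA, hlow, hup⟩ := ih
    have hA0 : 0 ≤ A := zero_le_one.trans hA
    by_cases ha : ‖a‖ ≤ 2 * R
    · refine ⟨a ::ₘ S', by simp [hc], ?_, A, hA, fun z hz => ?_, fun z => ?_⟩
      · intro b hb
        rcases Multiset.mem_cons.1 hb with rfl | hb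
        · exact ha
        · exact hS' b hb
      · rw [rootPoly_cons, rootPoly_cons, norm_mul, norm_mul, mul_left_comm]
        gcongr
        exact hlow z hz
      · rw [rootPoly_cons, norm_mul, Multiset.card_cons, pow_succ, ← mul_assoc, mul_comm]
        gcongr
        · exact hup z
        · exact (norm_sub_le _ _).trans (by linarith)
    · push Not at ha
      refine ⟨0 ::ₘ S', by simp [hc], ?_, A * (‖a‖ / (2 * R)), ?_, fun z hz => ?_, fun z => ?_⟩
      · intro b hb
        rcases Multiset.mem_cons.1 hb with rfl | hb
        · simp [hR.le]
        · exact hS' b hb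
      · exact one_le_mul_of_one_le_of_one_le hA ((one_le_div (by positivity)).2 ha.le)
      · rw [rootPoly_cons, rootPoly_cons, norm_mul, norm_mul, sub_zero]
        have h1 : ‖a‖ / (2 * R) * ‖z‖ ≤ ‖z - a‖ := by
          have h2 : ‖a‖ - ‖z‖ ≤ ‖z - a‖ := by
            rw [norm_sub_rev]
            exact norm_sub_norm_le a z
          have h3 : ‖a‖ / (2 * R) * ‖z‖ ≤ ‖a‖ / (2 * R) * R := by gcongr
          have h4 : ‖a‖ / (2 * R) * R = ‖a‖ / 2 := by field_simp
          linarith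
        calc _ = (‖a‖ / (2 * R) * ‖z‖) * (A * ‖(rootPoly S').eval z‖) := by ring
          _ ≤ _ := by
            gcongr
            exact hlow z hz
      · rw [rootPoly_cons, norm_mul, Multiset.card_cons]
        have h1 : ‖z - a‖ ≤ ‖a‖ / (2 * R) * (‖z‖ + 2 * R) := by
          have h2 : ‖z‖ ≤ ‖a‖ / (2 * R) * ‖z‖ :=
            le_mul_of_one_le_left (norm_nonneg _) ((one_le_div (by positivity)).2 ha.le)
          have h3 : ‖a‖ / (2 * R) * (2 * R) = ‖a‖ := by field_simp
          have := norm_sub_le z a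
          rw [mul_add, h3]
          linarith
        calc _ ≤ (‖a‖ / (2 * R) * (‖z‖ + 2 * R)) * (A * (‖z‖ + 2 * R) ^ S.card) := by
              gcongr
              exact hup z
          _ = _ := by ring

/-- Division with remainder of an entire function by a polynomial. -/
theorem exists_eq_rootPoly_mul_add (S : Multiset ℂ) {f : ℂ → ℂ} (hf : Differentiable ℂ f) :
    ∃ g : ℂ → ℂ, Differentiable ℂ g ∧ ∃ r ∈ Polynomial.degreeLT ℂ S.card,
      ∀ z, f z = (rootPoly S).eval z * g z + r.eval z := by
  induction S using Multiset.induction_on generalizing f with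
  | empty => exact ⟨f, hf, 0, Submodule.zero_mem _, fun z => by simp [eval_rootPoly_zero]⟩
  | cons a S ih =>
    have hd : Differentiable ℂ (dslope f a) := by
      rw [← differentiableOn_univ] at hf ⊢
      exact (Complex.differentiableOn_dslope univ_mem).2 hf
    obtain ⟨g, hg, r, hr, h⟩ := ih hd
    refine ⟨g, hg, (Polynomial.X - Polynomial.C a) * r + Polynomial.C (f a), ?_, fun z => ?_⟩
    · rw [Polynomial.mem_degreeLT] at hr ⊢
      rw [Multiset.card_cons]
      have h1 : (Polynomial.C (f a)).degree < ((S.card + 1 : ℕ) : WithBot ℕ) :=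
        Polynomial.degree_C_le.trans_lt (by exact_mod_cast Nat.succ_pos _)
      refine (Polynomial.degree_add_le _ _).trans_lt (max_lt ?_ h1)
      rw [Polynomial.degree_mul, Polynomial.degree_X_sub_C]
      by_cases hr0 : r = 0
      · simp [hr0]
      · rw [Polynomial.degree_eq_natDegree hr0] at hr ⊢
        have : r.natDegree < S.card := by exact_mod_cast hr
        exact_mod_cast (by omega : 1 + r.natDegree < S.card + 1)
    · have h2 := sub_smul_dslope f a z
      rw [h z, smul_eq_mul] at h2
      rw [rootPoly_cons]
      simp only [Polynomial.eval_add, Polynomial.eval_mul, Polynomial.eval_sub, Polynomial.eval_X,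
        Polynomial.eval_C]
      linear_combination -h2

theorem pow_le_norm_rootPoly {r ρ : ℝ} (hρ : r ≤ ρ) (S : Multiset ℂ) (hS : ∀ a ∈ S, ‖a‖ ≤ r)
    {z : ℂ} (hz : ‖z‖ = ρ) : (ρ - r) ^ S.card ≤ ‖(rootPoly S).eval z‖ := by
  induction S using Multiset.induction_on with
  | empty => simp [eval_rootPoly_zero]
  | cons a S ih =>
    rw [rootPoly_cons, norm_mul, Multiset.card_cons, pow_succ']
    have h1 : ρ - r ≤ ‖z - a‖ := by
      have := norm_sub_norm_le z a
      have := hS a (Multiset.mem_cons_self a S)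
      linarith
    have := ih fun b hb => hS b (Multiset.mem_cons_of_mem hb)
    have h0 : 0 ≤ ρ - r := by linarith
    gcongr

/-- If the roots of a polynomial lie in the disc of radius `r < ρ`, the quotient of an entire
function by it is controlled by the function on the circle of radius `ρ`. -/
theorem norm_quotient_le {r ρ B : ℝ} (hρ0 : 0 < ρ) (hρ : r < ρ) (S : Multiset ℂ)
    (hS : ∀ a ∈ S, ‖a‖ ≤ r)
    {g : ℂ → ℂ} (hg : Differentiable ℂ g) (hB : ∀ z, ‖z‖ = ρ → ‖(rootPoly S).eval z * g z‖ ≤ B)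
    {z : ℂ} (hz : ‖z‖ ≤ ρ) : ‖g z‖ ≤ B / (ρ - r) ^ S.card := by
  have hpos : 0 < (ρ - r) ^ S.card := pow_pos (by linarith) _
  refine Complex.norm_le_of_forall_mem_frontier_norm_le (U := Metric.ball 0 ρ)
    Metric.isBounded_ball hg.diffContOnCl ?_ ?_
  · intro w hw
    rw [frontier_ball _ hρ0.ne', mem_sphere_zero_iff_norm] at hw
    rw [le_div_iff₀ hpos, mul_comm]
    refine le_trans ?_ (hB w hw)
    rw [norm_mul]
    gcongr
    exact pow_le_norm_rootPoly hρ.le S hS hw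
  · rw [closure_ball _ hρ0.ne', mem_closedBall_zero_iff]
    exact hz

/-! ### Compactness and the min-max principle -/

section Hilbert

variable {H : Type*} [NormedAddCommGroup H] [InnerProductSpace ℂ H]

/-- `W` has codimension at most `n`, in the form in which it is used: `W` has a non-zero vector in
common with every subspace of dimension `n + 1`. No closedness of `W` is needed. -/
def CodimLE (W : Submodule ℂ H) (n : ℕ) : Prop :=
  ∀ V : Submodule ℂ H, Module.finrank ℂ V = n + 1 → ∃ u ∈ V, u ∈ W ∧ u ≠ 0

theorem CodimLE.finiteDimensional_orthogonal {W : Submodule ℂ H} {n : ℕ} (hW : CodimLE W n) :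
    FiniteDimensional ℂ Wᗮ := by
  by_contra h
  replace h : Cardinal.aleph0 ≤ Module.rank ℂ Wᗮ :=
    not_lt.1 fun h' => h (Module.rank_lt_aleph0_iff.1 h')
  obtain ⟨t, ht, hli⟩ := exists_finset_linearIndependent_of_le_rank
    (R := ℂ) (M := Wᗮ) (n := n + 1) ((Cardinal.natCast_le_aleph0).trans h)
  have hf : Module.finrank ℂ (Submodule.span ℂ (t : Set Wᗮ)) = n + 1 := by
    rw [finrank_span_finset_eq_card hli, ht]
  obtain ⟨u, hu, huW, hu0⟩ := hW ((Submodule.span ℂ (t : Set Wᗮ)).map Wᗮ.subtype) (by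
    rw [← hf]
    exact Submodule.finrank_map_subtype_eq Wᗮ _)
  obtain ⟨y, -, rfl⟩ := hu
  exact hu0 (inner_self_eq_zero.1 (Submodule.inner_right_of_mem_orthogonal huW y.2))

/-- An operator which is arbitrarily small on subspaces of finite codimension is compact. -/
theorem isCompactOperator_of_codimLE [CompleteSpace H] {K : Type*} [NormedAddCommGroup K]
    [NormedSpace ℂ K] [CompleteSpace K] (J : H →L[ℂ] K)
    (h : ∀ ε : ℝ, 0 < ε → ∃ (n : ℕ) (W : Submodule ℂ H), CodimLE W n ∧ ∀ u ∈ W, ‖J u‖ ≤ ε * ‖u‖) :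
    IsCompactOperator J := by
  have key : ∀ m : ℕ, ∃ F : H →L[ℂ] K, IsCompactOperator F ∧ ‖F - J‖ ≤ 1 / ((m : ℝ) + 1) := by
    intro m
    obtain ⟨n, W, hW, hs⟩ := h (1 / ((m : ℝ) + 1)) (by positivity)
    have := hW.finiteDimensional_orthogonal
    refine ⟨J ∘L Wᗮ.starProjection, ?_, ?_⟩
    · have h1 : IsCompactOperator (Wᗮ.subtypeL : Wᗮ →L[ℂ] H) :=
        isCompactOperator_of_locallyCompactSpace_rng Wᗮ.subtypeL
      have h2 : IsCompactOperator (Wᗮ.starProjection : H →L[ℂ] H) :=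
        h1.comp_clm Wᗮ.orthogonalProjectionOnto
      exact h2.clm_comp J
    · refine ContinuousLinearMap.opNorm_le_bound _ (by positivity) fun u => ?_
      have hcl : ∀ w ∈ closure (W : Set H), ‖J w‖ ≤ 1 / ((m : ℝ) + 1) * ‖w‖ := by
        have hc : IsClosed {w : H | ‖J w‖ ≤ 1 / ((m : ℝ) + 1) * ‖w‖} :=
          isClosed_le (by fun_prop) (by fun_prop)
        exact fun w hw => closure_minimal (fun x hx => hs x hx) hc hw
      have hmem : u - Wᗮ.starProjection u ∈ closure (W : Set H) := by
        have := Submodule.sub_starProjection_mem_orthogonal (K := Wᗮ) u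
        rw [Submodule.orthogonal_orthogonal_eq_closure] at this
        exact this
      have hle : ‖u - Wᗮ.starProjection u‖ ≤ ‖u‖ := by
        have h3 := Submodule.norm_sq_eq_add_norm_sq_starProjection u Wᗮ
        have h4 : Wᗮᗮ.starProjection u = u - Wᗮ.starProjection u := by
          rw [Submodule.starProjection_orthogonal']
          simp
        rw [h4] at h3
        exact abs_le_of_sq_le_sq' (by nlinarith [sq_nonneg ‖Wᗮ.starProjection u‖])
          (norm_nonneg _) |>.2
      have heq : (J ∘L Wᗮ.starProjection - J) u = -J (u - Wᗮ.starProjection u) := by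
        simp
      rw [heq, norm_neg]
      exact (hcl _ hmem).trans (by gcongr)
  choose F hF hFJ using key
  refine isCompactOperator_of_tendsto (F := F) (l := atTop) ?_ (Eventually.of_forall hF)
  rw [tendsto_iff_norm_sub_tendsto_zero]
  exact squeeze_zero (fun _ => norm_nonneg _) hFJ tendsto_one_div_add_atTop_nhds_zero_nat

/-- A compact nonnegative operator is bounded by `c` on the orthogonal complement of an invariant
subspace which contains all its eigenvectors with eigenvalues above `c`. -/
theorem re_inner_le_of_mem_orthogonal [CompleteSpace H] {T : H →L[ℂ] H} (hT : IsCompactOperator T)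
    (hsymm : (T : H →ₗ[ℂ] H).IsSymmetric) (hpos : ∀ u, 0 ≤ (inner ℂ (T u) u).re)
    {K : Submodule ℂ H} (hK : ∀ u ∈ K, T u ∈ K) {c : ℝ} (hc : 0 ≤ c)
    (hev : ∀ μ : ℝ, c < μ → ∀ x, T x = (μ : ℂ) • x → x ∈ K) {u : H} (hu : u ∈ Kᗮ) :
    (inner ℂ (T u) u).re ≤ c * ‖u‖ ^ 2 := by
  have hinv : ∀ w ∈ Kᗮ, T w ∈ Kᗮ := by
    intro w hw k hk
    have := hsymm k w
    simp only [ContinuousLinearMap.coe_coe] at this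
    rw [← this]
    exact hw _ (hK k hk)
  let S : Kᗮ →L[ℂ] Kᗮ := T.restrict hinv
  have hS : IsCompactOperator S := hT.restrict' hinv
  have hSsymm : (S : Kᗮ →ₗ[ℂ] Kᗮ).IsSymmetric := hsymm.restrict_invariant hinv
  have hnorm : ‖S‖ ≤ c := by
    have hsr := S.spectralRadius_eq_nnnorm hSsymm.isSelfAdjoint
    have hle : spectralRadius ℂ S ≤ (c.toNNReal : ℝ≥0∞) := by
      refine iSup₂_le fun k hk => ?_
      rw [ENNReal.coe_le_coe, ← NNReal.coe_le_coe, coe_nnnorm, Real.coe_toNNReal c hc]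
      by_cases hk0 : k = 0
      · simpa [hk0] using hc
      have hev' := (hS.hasEigenvalue_iff_mem_spectrum hk0).2 hk
      have hre := hSsymm.conj_eigenvalue_eq_self hev'
      obtain ⟨r, rfl⟩ := Complex.conj_eq_iff_real.1 hre
      obtain ⟨x, hx⟩ := hev'.exists_hasEigenvector
      have hTx : T (x : H) = (r : ℂ) • (x : H) := congrArg Subtype.val hx.apply_eq_smul
      have hx0 : (x : H) ≠ 0 := by simpa using hx.2
      have hxn : 0 < ‖(x : H)‖ ^ 2 := by positivity
      have hr : 0 ≤ r := by
        have := hpos x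
        rw [hTx, inner_smul_left, Complex.conj_ofReal, inner_self_eq_norm_sq_to_K,
          Complex.re_ofReal_mul] at this
        norm_cast at this
        exact nonneg_of_mul_nonneg_left this hxn
      rw [Complex.norm_real, Real.norm_eq_abs, abs_of_nonneg hr]
      by_contra hcr
      have := hev r (not_le.1 hcr) x hTx
      exact hx0 (inner_self_eq_zero.1 (x.2 _ this))
    rw [hsr] at hle
    rwa [ENNReal.coe_le_coe, ← NNReal.coe_le_coe, coe_nnnorm, Real.coe_toNNReal c hc] at hle
  calc (inner ℂ (T u) u).re ≤ ‖inner ℂ (T u) u‖ := Complex.re_le_norm _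
    _ ≤ ‖T u‖ * ‖u‖ := norm_inner_le_norm _ _
    _ = ‖S ⟨u, hu⟩‖ * ‖u‖ := rfl
    _ ≤ (‖S‖ * ‖u‖) * ‖u‖ := by
      gcongr
      exact S.le_opNorm ⟨u, hu⟩
    _ ≤ (c * ‖u‖) * ‖u‖ := by gcongr
    _ = _ := by ring

/-- A subspace of dimension larger than that of `K` meets the orthogonal complement of `K`. -/
theorem exists_mem_orthogonal_of_finrank_lt {V K : Submodule ℂ H} [FiniteDimensional ℂ V]
    [FiniteDimensional ℂ K] (h : Module.finrank ℂ K < Module.finrank ℂ V) :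
    ∃ u ∈ V, u ∈ Kᗮ ∧ u ≠ 0 := by
  have hker := LinearMap.ker_ne_bot_of_finrank_lt
    (f := (K.orthogonalProjectionOnto : H →ₗ[ℂ] K) ∘ₗ V.subtype) h
  obtain ⟨y, hy, hy0⟩ := Submodule.exists_mem_ne_zero_of_ne_bot hker
  refine ⟨y, y.2, ?_, by simpa using hy0⟩
  rw [← Submodule.orthogonalProjectionOnto_eq_zero_iff]
  simpa using hy

/-- The upper bound in the min-max principle. -/
theorem le_of_codimLE {T : H →L[ℂ] H} {ι : Type*} {e : ι → H} (he : Orthonormal ℂ e) {l : ι → ℝ}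
    (hl : ∀ i, T (e i) = (l i : ℂ) • e i) {A : Finset ι} {t : ℝ} (ht : ∀ i ∈ A, t ≤ l i)
    {W : Submodule ℂ H} {n : ℕ} (hW : CodimLE W n) (hA : A.card = n + 1) {C : ℝ}
    (hC : ∀ u ∈ W, (inner ℂ (T u) u).re ≤ C * ‖u‖ ^ 2) : t ≤ C := by
  have hli : LinearIndependent ℂ fun i : A => e i :=
    he.linearIndependent.comp _ Subtype.val_injective
  obtain ⟨u, hu, huW, hu0⟩ := hW (Submodule.span ℂ (Set.range fun i : A => e i)) (by
    rw [finrank_span_eq_card hli, Fintype.card_coe, hA])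
  obtain ⟨a, rfl⟩ := (Submodule.mem_span_range_iff_exists_fun ℂ).1 hu
  have he' : Orthonormal ℂ fun i : A => e i := he.comp _ Subtype.val_injective
  set u := ∑ i, a i • e i with hudef
  have hTu : T u = ∑ i, (a i * l i) • e (i : A) := by
    rw [hudef, map_sum]
    refine Finset.sum_congr rfl fun i _ => ?_
    rw [map_smul, hl, smul_smul]
  have hin : (inner ℂ (T u) u).re = ∑ i, l (i : A) * ‖a i‖ ^ 2 := by
    rw [hTu, hudef, he'.inner_sum, Complex.re_sum]
    refine Finset.sum_congr rfl fun i _ => ?_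
    rw [map_mul, Complex.conj_ofReal, mul_right_comm, Complex.conj_mul', mul_comm]
    norm_cast
  have hnn : ‖u‖ ^ 2 = ∑ i, ‖a i‖ ^ 2 := by
    have : ((‖u‖ ^ 2 : ℝ) : ℂ) = ∑ i, ((‖a i‖ ^ 2 : ℝ) : ℂ) := by
      have h1 := inner_self_eq_norm_sq_to_K (𝕜 := ℂ) u
      push_cast
      rw [← Complex.coe_algebraMap] at *
      refine h1.symm.trans ?_
      rw [hudef, he'.inner_sum]
      refine Finset.sum_congr rfl fun i _ => ?_
      rw [Complex.conj_mul']
      rfl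
    exact_mod_cast this
  have hu2 : 0 < ‖u‖ ^ 2 := by positivity
  have h1 : t * ‖u‖ ^ 2 ≤ C * ‖u‖ ^ 2 := by
    refine le_trans ?_ (hC u huW)
    rw [hin, hnn, Finset.mul_sum]
    exact Finset.sum_le_sum fun i _ => mul_le_mul_of_nonneg_right (ht i i.2) (by positivity)
  exact le_of_mul_le_mul_right h1 hu2

/-- The lower bound in the min-max principle. -/
theorem le_of_forall_mem_le [CompleteSpace H] {T : H →L[ℂ] H} (hT : IsCompactOperator T)
    (hsymm : (T : H →ₗ[ℂ] H).IsSymmetric) (hpos : ∀ u, 0 ≤ (inner ℂ (T u) u).re)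
    {e : ℕ → H} {s : ℕ → ℝ} (hs : Antitone s) (hs0 : ∀ n, 0 < s n)
    (hse : ∀ n, T (e n) = (s n : ℂ) • e n)
    (hspan : ∀ μ : ℝ, 0 < μ → ∀ x, T x = (μ : ℂ) • x → x ∈ Submodule.span ℂ (e '' {n | s n = μ}))
    {n : ℕ} {V : Submodule ℂ H} (hV : Module.finrank ℂ V = n + 1) {c : ℝ}
    (hc : ∀ u ∈ V, c * ‖u‖ ^ 2 ≤ (inner ℂ (T u) u).re) : c ≤ s n := by
  classical
  set K := Submodule.span ℂ (((Finset.range n).image e : Finset H) : Set H) with hKdef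
  have hKinv : ∀ u ∈ K, T u ∈ K := by
    intro u hu
    have : K ≤ K.comap (T : H →ₗ[ℂ] H) := by
      rw [hKdef, Submodule.span_le]
      intro x hx
      obtain ⟨i, hi, rfl⟩ := Finset.mem_image.1 (Finset.mem_coe.1 hx)
      rw [SetLike.mem_coe, Submodule.mem_comap, ContinuousLinearMap.coe_coe, hse]
      exact Submodule.smul_mem _ _ (Submodule.subset_span hx)
    exact this hu
  have hVfd : FiniteDimensional ℂ V := Module.finite_of_finrank_pos (by omega)
  have hKfd : FiniteDimensional ℂ K := FiniteDimensional.span_finset ℂ _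
  obtain ⟨u, huV, huK, hu0⟩ := exists_mem_orthogonal_of_finrank_lt (V := V) (K := K) (by
    rw [hV]
    refine Nat.lt_succ_of_le ((finrank_span_finset_le_card _).trans ?_)
    exact Finset.card_image_le.trans (by simp))
  have hu2 : 0 < ‖u‖ ^ 2 := by positivity
  refine le_of_mul_le_mul_right ((hc u huV).trans ?_) hu2
  refine re_inner_le_of_mem_orthogonal hT hsymm hpos hKinv (hs0 n).le (fun μ hμ x hx => ?_) huK
  refine Submodule.span_mono ?_ (hspan μ ((hs0 n).trans hμ) x hx)
  rintro _ ⟨m, hm, rfl⟩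
  rw [Set.mem_ofPred_eq] at hm
  refine Finset.mem_coe.2 (Finset.mem_image_of_mem e (Finset.mem_range.2 ?_))
  by_contra hmn
  have := hs (not_lt.1 hmn)
  linarith

end Hilbert

/-- An infinite family of numbers of which only finitely many lie above each of its members can be
arranged in decreasing order. -/
theorem exists_equiv_antitone {I : Type*} [Infinite I] (f : I → ℝ)
    (hfin : ∀ i, {j | f i ≤ f j}.Finite) : ∃ e : ℕ ≃ I, Antitone (f ∘ e) := by
  classical
  let o : LinearOrder I := linearOrderOfSTO WellOrderingRel
  let g : I → ℝ ×ₗ I := fun i => toLex (-f i, i)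
  have hg : Function.Injective g := fun i j h => by
    have := congrArg (fun x => (ofLex x).2) h
    simpa [g] using this
  obtain ⟨o', hle⟩ : ∃ o' : LinearOrder I, ∀ i j, o'.le i j → f j ≤ f i := by
    refine ⟨LinearOrder.lift' g hg, fun i j h => ?_⟩
    have h' : g i ≤ g j := h
    rw [Prod.Lex.le_iff] at h'
    simp only [g, ofLex_toLex, neg_lt_neg_iff, neg_inj] at h'
    rcases h' with h' | h'
    · exact h'.le
    · exact h'.1.ge
  clear hg g o
  have hIic : ∀ i : I, (Set.Iic i).Finite := fun i => (hfin i).subset fun j hj => hle j i hj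
  let _ : LocallyFiniteOrder I := LocallyFiniteOrder.ofFiniteIcc fun a b =>
    (hIic b).subset fun x hx => hx.2
  have hne : Nonempty I := inferInstance
  obtain ⟨i₀⟩ := hne
  obtain ⟨b, hb⟩ := (hIic i₀).exists_minimal ⟨i₀, le_rfl⟩
  let _ : OrderBot I :=
    { bot := b
      bot_le := fun a => (le_total b a).elim id fun h => hb.2 (h.trans hb.1) h }
  have : NoMaxOrder I := by
    refine ⟨fun a => ?_⟩
    by_contra hcon
    push Not at hcon
    exact Set.infinite_univ ((hIic a).subset fun x _ => hcon x)
  let _ := LinearLocallyFiniteOrder.succOrder I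
  let _ := LinearLocallyFiniteOrder.predOrder I
  exact ⟨(orderIsoNatOfLinearSuccPredArch (ι := I)).symm.toEquiv, fun m n hmn =>
    hle _ _ ((orderIsoNatOfLinearSuccPredArch (ι := I)).symm.monotone hmn)⟩

/-! ### Sequences of eigenvalues -/

section Eigen

open Module.End

variable {T : L2 →L[ℂ] L2}

/-- The sequence of eigenvalues comes with an orthonormal sequence of eigenvectors, which exhausts
the eigenspaces of the positive eigenvalues. -/
theorem IsEigenvalueSeq.exists_orthonormal {s : ℕ → ℝ} (hs : IsEigenvalueSeq T s)
    (hsymm : (T : L2 →ₗ[ℂ] L2).IsSymmetric) :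
    ∃ e : ℕ → L2, Orthonormal ℂ e ∧ (∀ n, T (e n) = (s n : ℂ) • e n) ∧
      ∀ μ : ℝ, 0 < μ → ∀ x, T x = (μ : ℂ) • x → x ∈ Submodule.span ℂ (e '' {n | s n = μ}) := by
  classical
  have key : ∀ r : ℝ, ∃ f : ℕ → L2, 0 < r →
      (∀ n, f n ∈ eigenspace (T : L2 →ₗ[ℂ] L2) (r : ℂ)) ∧
      Orthonormal ℂ (fun n : {n | s n = r} => f n) ∧
      eigenspace (T : L2 →ₗ[ℂ] L2) (r : ℂ) ≤ Submodule.span ℂ (f '' {n | s n = r}) := by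
    intro r
    by_cases hr : 0 < r
    swap
    · exact ⟨0, fun h => absurd h hr⟩
    have hr0 : (r : ℂ) ≠ 0 := by exact_mod_cast hr.ne'
    have hfd := hs.finite_mult r hr0
    have hcard := hs.card_eq r hr0
    simp only [Complex.ofReal_inj] at hcard
    have hfin : {n | s n = r}.Finite := Set.finite_of_encard_eq_coe hcard
    have := hfin.fintype
    have hc : Fintype.card {n | s n = r} =
        Module.finrank ℂ (eigenspace (T : L2 →ₗ[ℂ] L2) (r : ℂ)) := by
      rw [Set.encard_eq_coe_toFinset_card, Set.toFinset_card] at hcard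
      exact_mod_cast hcard
    let b := stdOrthonormalBasis ℂ (eigenspace (T : L2 →ₗ[ℂ] L2) (r : ℂ))
    let q := Fintype.equivFinOfCardEq hc
    let f : ℕ → L2 := fun n => if h : s n = r then b (q ⟨n, h⟩) else 0
    have hf : ∀ n : {n | s n = r}, f n = b (q n) := fun n => dif_pos n.2
    refine ⟨f, fun _ => ⟨fun n => ?_, ?_, ?_⟩⟩
    · by_cases h : s n = r
      · rw [hf ⟨n, h⟩]
        exact Submodule.coe_mem _
      · simp [f, h]
    · simp only [hf]
      exact (b.orthonormal.comp_linearIsometry (Submodule.subtypeₗᵢ _)).comp q q.injective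
    · intro x hx
      have h1 : (⟨x, hx⟩ : eigenspace (T : L2 →ₗ[ℂ] L2) (r : ℂ)) ∈
          Submodule.span ℂ (Set.range b) := by
        rw [← OrthonormalBasis.coe_toBasis, b.toBasis.span_eq]
        trivial
      have h2 := Submodule.mem_map_of_mem (f := Submodule.subtype _) h1
      rw [Submodule.map_span] at h2
      refine Submodule.span_mono ?_ h2
      rintro _ ⟨_, ⟨i, rfl⟩, rfl⟩
      refine ⟨q.symm i, (q.symm i).2, ?_⟩
      rw [hf, q.apply_symm_apply]
      rfl
  choose f hf using key
  have hmem : ∀ n, f (s n) n ∈ eigenspace (T : L2 →ₗ[ℂ] L2) (s n : ℂ) :=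
    fun n => (hf (s n) (hs.pos n)).1 n
  refine ⟨fun n => f (s n) n, ⟨fun n => (hf (s n) (hs.pos n)).2.1.1 ⟨n, rfl⟩, fun m n hmn => ?_⟩,
    fun n => mem_eigenspace_iff.1 (hmem n), fun μ hμ x hx => ?_⟩
  · by_cases h : s m = s n
    · have := (hf (s n) (hs.pos n)).2.1.2 (i := ⟨m, h⟩) (j := ⟨n, rfl⟩)
        (fun h' => hmn (congrArg Subtype.val h'))
      simpa [h] using this
    · exact hsymm.orthogonalFamily_eigenspaces (i := (s m : ℂ)) (j := (s n : ℂ))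
        (fun h' => h (by exact_mod_cast h')) ⟨_, hmem m⟩ ⟨_, hmem n⟩
  · have h1 := (hf μ hμ).2.2 (mem_eigenspace_iff.2 hx)
    have h2 : (fun n => f (s n) n) '' {n | s n = μ} = f μ '' {n | s n = μ} := by
      refine Set.image_congr fun n hn => ?_
      rw [Set.mem_ofPred_eq] at hn
      simp only [hn]
    rwa [h2]

/-- A nonnegative compact operator of infinite rank has a sequence of eigenvalues. -/
theorem exists_eigenvalue_sequence {H : Type*} [NormedAddCommGroup H]
    [InnerProductSpace ℂ H] [CompleteSpace H] {T : H →L[ℂ] H} (hT : IsCompactOperator T)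
    (hsymm : (T : H →ₗ[ℂ] H).IsSymmetric) (hpos : ∀ u, 0 ≤ (inner ℂ (T u) u).re)
    (hsmall : ∀ ε : ℝ, 0 < ε → ∃ (n : ℕ) (W : Submodule ℂ H), CodimLE W n ∧
      ∀ u ∈ W, (inner ℂ (T u) u).re ≤ ε * ‖u‖ ^ 2)
    (hlarge : ∀ n : ℕ, ∃ V : Submodule ℂ H, Module.finrank ℂ V = n + 1 ∧
      ∀ u ∈ V, u ≠ 0 → 0 < (inner ℂ (T u) u).re) :
    ∃ s : ℕ → ℝ, Antitone s ∧ (∀ n, 0 < s n) ∧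
      (∀ μ : ℂ, μ ≠ 0 → FiniteDimensional ℂ (eigenspace (T : H →ₗ[ℂ] H) μ)) ∧
      ∀ μ : ℂ, μ ≠ 0 → {n : ℕ | (s n : ℂ) = μ}.encard =
        (Module.finrank ℂ (eigenspace (T : H →ₗ[ℂ] H) μ) : ℕ∞) := by
  let E : {r : ℝ // 0 < r} → Submodule ℂ H := fun r =>
    eigenspace (T : H →ₗ[ℂ] H) ((r : ℝ) : ℂ)
  have hfd0 : ∀ μ : ℂ, μ ≠ 0 → FiniteDimensional ℂ (eigenspace (T : H →ₗ[ℂ] H) μ) :=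
    fun μ hμ => T.finite_dimensional_eigenspace hT μ hμ
  have hfd : ∀ r, FiniteDimensional ℂ (E r) := fun r =>
    hfd0 _ (by exact_mod_cast r.2.ne')
  let I := Σ r : {r : ℝ // 0 < r}, Fin (Module.finrank ℂ (E r))
  let vec : I → H := fun a => stdOrthonormalBasis ℂ (E a.1) a.2
  let val : I → ℝ := fun a => a.1
  have hvec : Orthonormal ℂ vec := by
    have hO : OrthogonalFamily ℂ (fun r => E r) fun r => (E r).subtypeₗᵢ :=
      hsymm.orthogonalFamily_eigenspaces.comp (γ := {r : ℝ // 0 < r}) (f := fun r => ((r : ℝ) : ℂ))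
        fun a b h => Subtype.ext (Complex.ofReal_injective h)
    exact hO.orthonormal_sigma_orthonormal fun r => (stdOrthonormalBasis ℂ (E r)).orthonormal
  have hval : ∀ a, T (vec a) = (val a : ℂ) • vec a := fun a =>
    mem_eigenspace_iff.1 (stdOrthonormalBasis ℂ (E a.1) a.2).2
  -- Above any positive level there are finitely many eigenvalues.
  have hfin : ∀ i, {j | val i ≤ val j}.Finite := by
    intro i
    by_contra hinf
    have hi : 0 < val i := i.1.2
    obtain ⟨n, W, hW, hC⟩ := hsmall (val i / 2) (by positivity)
    obtain ⟨A, hA, hAc⟩ := Set.Infinite.exists_subset_card_eq hinf (n + 1)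
    have := le_of_codimLE hvec hval (A := A) (t := val i) (fun j hj => hA hj) hW hAc hC
    linarith
  have hEspan : ∀ μ : ℝ, 0 < μ → ∀ x, T x = (μ : ℂ) • x →
      x ∈ Submodule.span ℂ (Set.range vec) := by
    intro μ hμ x hx
    let b := stdOrthonormalBasis ℂ (E ⟨μ, hμ⟩)
    have h1 : (⟨x, mem_eigenspace_iff.2 hx⟩ : E ⟨μ, hμ⟩) ∈ Submodule.span ℂ (Set.range b) := by
      rw [← OrthonormalBasis.coe_toBasis, b.toBasis.span_eq]
      trivial
    have h2 := Submodule.mem_map_of_mem (f := Submodule.subtype _) h1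
    rw [Submodule.map_span] at h2
    refine Submodule.span_mono ?_ h2
    rintro _ ⟨_, ⟨i, rfl⟩, rfl⟩
    exact ⟨⟨⟨μ, hμ⟩, i⟩, rfl⟩
  have hinf : Infinite I := by
    by_contra hI
    rw [not_infinite_iff_finite] at hI
    set K := Submodule.span ℂ (Set.range vec) with hKdef
    have hKfd : FiniteDimensional ℂ K := FiniteDimensional.span_of_finite ℂ (Set.finite_range vec)
    have hKinv : ∀ u ∈ K, T u ∈ K := by
      intro u hu
      have : K ≤ K.comap (T : H →ₗ[ℂ] H) := by
        rw [hKdef, Submodule.span_le]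
        rintro _ ⟨i, rfl⟩
        rw [SetLike.mem_coe, Submodule.mem_comap, ContinuousLinearMap.coe_coe, hval]
        exact Submodule.smul_mem _ _ (Submodule.subset_span ⟨i, rfl⟩)
      exact this hu
    obtain ⟨V, hV, hVpos⟩ := hlarge (Module.finrank ℂ K)
    have hVfd : FiniteDimensional ℂ V := Module.finite_of_finrank_pos (by omega)
    obtain ⟨u, huV, huK, hu0⟩ := exists_mem_orthogonal_of_finrank_lt (V := V) (K := K) (by omega)
    have h1 := re_inner_le_of_mem_orthogonal hT hsymm hpos hKinv le_rfl hEspan huK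
    have h2 := hVpos u huV hu0
    linarith
  obtain ⟨e, he⟩ := exists_equiv_antitone val hfin
  refine ⟨fun n => val (e n), he, fun n => (e n).1.2, hfd0, fun μ hμ => ?_⟩
  by_cases hμr : ∃ r : ℝ, 0 < r ∧ (r : ℂ) = μ
  · obtain ⟨r, hr, rfl⟩ := hμr
    have h1 : {n : ℕ | ((val (e n) : ℝ) : ℂ) = (r : ℂ)} = e ⁻¹' {a | val a = r} := by
      ext n
      simp
    have h2 : {a : I | val a = r} = Set.range fun i : Fin (Module.finrank ℂ (E ⟨r, hr⟩)) =>
        (⟨⟨r, hr⟩, i⟩ : I) := by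
      ext ⟨⟨r', hr'⟩, i⟩
      simp only [Set.mem_ofPred_eq, Set.mem_range, val]
      constructor
      · rintro rfl
        exact ⟨i, rfl⟩
      · rintro ⟨j, hj⟩
        have := congrArg (fun a : I => (a.1 : ℝ)) hj
        exact this.symm
    rw [h1, Set.encard_preimage_of_bijective e.bijective, h2, ← Set.image_univ,
      Function.Injective.encard_image, Set.encard_univ, ENat.card_eq_coe_fintype_card,
      Fintype.card_fin]
    intro i j hij
    exact eq_of_heq (Sigma.mk.inj (show (⟨⟨r, hr⟩, i⟩ : I) = ⟨⟨r, hr⟩, j⟩ from hij)).2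
  · have h1 : {n : ℕ | ((val (e n) : ℝ) : ℂ) = μ} = ∅ := by
      ext n
      simp only [Set.mem_ofPred_eq, Set.mem_empty_iff_false, iff_false]
      exact fun h => hμr ⟨_, (e n).1.2, h⟩
    have h2 : eigenspace (T : H →ₗ[ℂ] H) μ = ⊥ := by
      by_contra hne
      have hev : HasEigenvalue (T : H →ₗ[ℂ] H) μ := hne
      obtain ⟨r, rfl⟩ := Complex.conj_eq_iff_real.1 (hsymm.conj_eigenvalue_eq_self hev)
      obtain ⟨x, hx⟩ := hev.exists_hasEigenvector
      have hTx : T x = (r : ℂ) • x := hx.apply_eq_smul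
      have h3 := hpos x
      rw [hTx, inner_smul_left, Complex.conj_ofReal, inner_self_eq_norm_sq_to_K,
        Complex.re_ofReal_mul] at h3
      norm_cast at h3
      have hxn : 0 < ‖x‖ ^ 2 := by
        have := hx.2
        positivity
      have hr : 0 ≤ r := nonneg_of_mul_nonneg_left h3 hxn
      exact hμr ⟨r, lt_of_le_of_ne hr fun h => hμ (by simp [← h]), rfl⟩
    rw [h1, h2]
    simp

theorem exists_isEigenvalueSeq (hT : IsCompactOperator T)
    (hsymm : (T : L2 →ₗ[ℂ] L2).IsSymmetric) (hpos : ∀ u, 0 ≤ (inner ℂ (T u) u).re)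
    (hsmall : ∀ ε : ℝ, 0 < ε → ∃ (n : ℕ) (W : Submodule ℂ L2), CodimLE W n ∧
      ∀ u ∈ W, (inner ℂ (T u) u).re ≤ ε * ‖u‖ ^ 2)
    (hlarge : ∀ n : ℕ, ∃ V : Submodule ℂ L2, Module.finrank ℂ V = n + 1 ∧
      ∀ u ∈ V, u ≠ 0 → 0 < (inner ℂ (T u) u).re) :
    ∃ s : ℕ → ℝ, IsEigenvalueSeq T s := by
  obtain ⟨s, h1, h2, h3, h4⟩ := exists_eigenvalue_sequence hT hsymm hpos hsmall hlarge
  exact ⟨s, h1, h2, h3, h4⟩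

theorem IsEigenvalueSeq.le_of_codimLE {s : ℕ → ℝ} (hs : IsEigenvalueSeq T s)
    (hsymm : (T : L2 →ₗ[ℂ] L2).IsSymmetric) {W : Submodule ℂ L2} {n : ℕ} (hW : CodimLE W n) {C : ℝ}
    (hC : ∀ u ∈ W, (inner ℂ (T u) u).re ≤ C * ‖u‖ ^ 2) : s n ≤ C := by
  obtain ⟨e, he, hse, -⟩ := hs.exists_orthonormal hsymm
  refine PauliOp.le_of_codimLE he hse (A := Finset.range (n + 1)) (fun i hi => ?_) hW (by simp) hC
  exact hs.antitone (Nat.lt_succ_iff.1 (Finset.mem_range.1 hi))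

theorem IsEigenvalueSeq.le_of_forall_mem_le {s : ℕ → ℝ} (hs : IsEigenvalueSeq T s)
    (hT : IsCompactOperator T) (hsymm : (T : L2 →ₗ[ℂ] L2).IsSymmetric)
    (hpos : ∀ u, 0 ≤ (inner ℂ (T u) u).re) {n : ℕ} {V : Submodule ℂ L2}
    (hV : Module.finrank ℂ V = n + 1) {c : ℝ}
    (hc : ∀ u ∈ V, c * ‖u‖ ^ 2 ≤ (inner ℂ (T u) u).re) : c ≤ s n := by
  obtain ⟨e, he, hse, hspan⟩ := hs.exists_orthonormal hsymm
  exact PauliOp.le_of_forall_mem_le hT hsymm hpos hs.antitone hs.pos hse hspan hV hc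

end Eigen

/-! ### The kernel of the Pauli operator -/

section Fock

theorem norm_sq_eq_integral (u : L2) : ‖u‖ ^ 2 = ∫ z, ‖u z‖ ^ 2 := by
  have h := inner_self_eq_norm_sq_to_K (𝕜 := ℂ) u
  rw [L2.inner_def] at h
  have h1 : ∀ z, inner ℂ (u z) (u z) = ((‖u z‖ ^ 2 : ℝ) : ℂ) := fun z => by
    rw [inner_self_eq_norm_sq_to_K]
    norm_cast
  simp_rw [h1] at h
  rw [integral_complex_ofReal] at h
  have h2 : ((∫ z, ‖u z‖ ^ 2 : ℝ) : ℂ) = ((‖u‖ ^ 2 : ℝ) : ℂ) := by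
    rw [h]
    norm_cast
  exact_mod_cast h2.symm

theorem integrable_norm_sq (u : L2) : Integrable fun z => ‖u z‖ ^ 2 :=
  (memLp_two_iff_integrable_sq_norm (Lp.aestronglyMeasurable u)).1 (Lp.memLp u)

theorem exists_ae_abs_le (Ψ₁ : Lp ℝ ∞ (volume : Measure ℂ)) :
    ∃ C : ℝ, 0 ≤ C ∧ ∀ᵐ z : ℂ, |Ψ₁ z| ≤ C := by
  refine ⟨(eLpNormEssSup Ψ₁ volume).toReal, ENNReal.toReal_nonneg, ?_⟩
  have hfin : eLpNormEssSup Ψ₁ volume ≠ ⊤ := by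
    have := (Lp.memLp Ψ₁).eLpNorm_ne_top
    rwa [eLpNorm_exponent_top] at this
  filter_upwards [ae_le_eLpNormEssSup (f := Ψ₁) (μ := volume)] with z hz
  simpa using ENNReal.toReal_mono hfin hz

variable (B₀ : ℝ) (Ψ₁ : Lp ℝ ∞ (volume : Measure ℂ))

/-- The function `e^{-Ψ} f`, which is in `Ker h⁺` if `f` is entire and the product is in `L²`. -/
noncomputable def weighted (f : ℂ → ℂ) (z : ℂ) : ℂ :=
  (Real.exp (-potential B₀ Ψ₁ z) : ℂ) * f z

variable {B₀ Ψ₁}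

theorem norm_sq_weighted (f : ℂ → ℂ) (z : ℂ) : ‖weighted B₀ Ψ₁ f z‖ ^ 2 =
    Real.exp (-2 * Ψ₁ z) * (‖f z‖ ^ 2 * Real.exp (-(B₀ / 2) * ‖z‖ ^ 2)) := by
  rw [weighted, norm_mul, Complex.norm_real, Real.norm_eq_abs, Real.abs_exp, mul_pow,
    ← Real.exp_nat_mul, mul_left_comm, ← Real.exp_add, mul_comm]
  congr 2
  rw [potential]
  push_cast
  ring

theorem aestronglyMeasurable_weighted {f : ℂ → ℂ} (hf : Continuous f) :
    AEStronglyMeasurable (weighted B₀ Ψ₁ f) volume := by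
  have h1 : AEStronglyMeasurable (potential B₀ Ψ₁) volume := by
    unfold potential
    exact (by fun_prop : Continuous fun z : ℂ => B₀ / 4 * ‖z‖ ^ 2).aestronglyMeasurable.add
      (Lp.aestronglyMeasurable Ψ₁)
  have h2 : AEStronglyMeasurable (fun z => (Real.exp (-potential B₀ Ψ₁ z) : ℂ)) volume :=
    (by fun_prop : Continuous fun x : ℝ => (Real.exp (-x) : ℂ)).comp_aestronglyMeasurable h1
  exact h2.mul hf.aestronglyMeasurable

/-- The elements of `Ker h⁺` are the products `e^{-Ψ} f` with `f` entire. -/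
theorem exists_entire_of_mem_ker {u : L2} (hu : u ∈ kerPauliPlus B₀ Ψ₁) :
    ∃ f : ℂ → ℂ, Differentiable ℂ f ∧ u =ᵐ[volume] weighted B₀ Ψ₁ f := by
  obtain ⟨f, hf, h⟩ := exists_entire_of_integral_dbar
    (locallyIntegrable_exp_mul (B₀ := B₀) (Ψ₁ := Ψ₁) u) ((pauliPlusApply_zero_iff u).1 hu)
  refine ⟨f, hf, ?_⟩
  filter_upwards [h] with z hz
  rw [weighted, ← hz, ← mul_assoc, ← Complex.ofReal_mul, ← Real.exp_add]
  simp

theorem integral_mul_dbar_of_entire {f : ℂ → ℂ} (hf : Differentiable ℂ f) {φ : ℂ → ℂ}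
    (hφ : ContDiff ℝ ∞ φ) (hs : HasCompactSupport φ) : ∫ z, f z * dbar φ z = 0 := by
  have hfR : Differentiable ℝ f := hf.restrictScalars ℝ
  have hfc : ContDiff ℝ ∞ f := hf.contDiff.restrict_scalars ℝ
  have hcf : Continuous (fderiv ℝ f) := hfc.continuous_fderiv (by simp)
  have hcφ : Continuous (fderiv ℝ φ) := hφ.continuous_fderiv (by simp)
  have hsd : ∀ v, HasCompactSupport fun z => fderiv ℝ φ z v := fun v =>
    (hs.fderiv ℝ).comp_left (g := fun L : ℂ →L[ℝ] ℂ => L v) (by simp)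
  have hi1 : ∀ v, Integrable fun z => f z * fderiv ℝ φ z v := fun v =>
    (by fun_prop : Continuous fun z => f z * fderiv ℝ φ z v).integrable_of_hasCompactSupport
      (hsd v).mul_left
  have hi2 : ∀ v, Integrable fun z => fderiv ℝ f z v * φ z := fun v =>
    ((by fun_prop : Continuous fun z => fderiv ℝ f z v).mul
      hφ.continuous).integrable_of_hasCompactSupport hs.mul_left
  have hi3 : Integrable fun z => f z * φ z :=
    (hf.continuous.mul hφ.continuous).integrable_of_hasCompactSupport hs.mul_left
  have hip : ∀ v, ∫ z, f z * fderiv ℝ φ z v = -∫ z, fderiv ℝ f z v * φ z := fun v =>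
    integral_mul_fderiv_eq_neg_fderiv_mul_of_integrable (hi2 v) (hi1 v) hi3
      (fun z _ => hfR z) fun z _ => (hφ.differentiable (by simp)) z
  have hCR : ∀ z, fderiv ℝ f z Complex.I * φ z = Complex.I * (fderiv ℝ f z 1 * φ z) := fun z => by
    rw [(differentiableAt_complex_iff_differentiableAt_real.1 (hf z)).2, smul_eq_mul, mul_assoc]
  have heq : ∀ z, f z * dbar φ z = (1 / 2 : ℂ) * (f z * fderiv ℝ φ z 1) +
      Complex.I / 2 * (f z * fderiv ℝ φ z Complex.I) := fun z => by
    rw [dbar]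
    ring
  simp_rw [heq]
  rw [integral_add ((hi1 1).const_mul _) ((hi1 Complex.I).const_mul _), integral_const_mul,
    integral_const_mul, hip, hip]
  simp_rw [hCR]
  rw [integral_const_mul]
  linear_combination (-(1 / 2 : ℂ) * ∫ z, fderiv ℝ f z 1 * φ z) * Complex.I_sq

theorem toLp_mem_ker {f : ℂ → ℂ} (hf : Differentiable ℂ f)
    (hm : MemLp (weighted B₀ Ψ₁ f) 2 volume) : hm.toLp _ ∈ kerPauliPlus B₀ Ψ₁ := by
  refine (pauliPlusApply_zero_iff _).2 fun φ hφ hs => ?_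
  rw [← integral_mul_dbar_of_entire hf hφ hs]
  refine integral_congr_ae ?_
  filter_upwards [hm.coeFn_toLp] with z hz
  rw [hz, weighted, ← mul_assoc, ← Complex.ofReal_mul, ← Real.exp_add]
  simp

/-- Pointwise bounds for the entire functions which correspond to elements of `Ker h⁺`. -/
theorem exists_sq_norm_le (hB₀ : 0 ≤ B₀) : ∃ C : ℝ, 0 < C ∧ ∀ (u : L2) (f : ℂ → ℂ),
    Differentiable ℂ f → u =ᵐ[volume] weighted B₀ Ψ₁ f →
      ∀ z, ‖f z‖ ^ 2 ≤ C * Real.exp (B₀ / 2 * (‖z‖ + 1) ^ 2) * ‖u‖ ^ 2 := by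
  obtain ⟨C, hC, hball⟩ := exists_sq_norm_le_integral_ball
  obtain ⟨D, hD, hΨ⟩ := exists_ae_abs_le Ψ₁
  refine ⟨C * Real.exp (2 * D), by positivity, fun u f hf huf z => (hball f hf z).trans ?_⟩
  have hfc := hf.continuous
  have hfi : IntegrableOn (fun w => ‖f w‖ ^ 2) (Metric.ball z 1) :=
    ((by fun_prop : Continuous fun w => ‖f w‖ ^ 2).locallyIntegrable.integrableOn_isCompact
      (isCompact_closedBall z 1)).mono_set Metric.ball_subset_closedBall
  have hui := integrable_norm_sq u
  have hle : ∫ w in Metric.ball z 1, ‖f w‖ ^ 2 ≤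
      ∫ w in Metric.ball z 1, Real.exp (2 * D) * Real.exp (B₀ / 2 * (‖z‖ + 1) ^ 2) * ‖u w‖ ^ 2 := by
    refine integral_mono_ae hfi (hui.const_mul _).integrableOn ?_
    filter_upwards [ae_restrict_mem Metric.isOpen_ball.measurableSet, ae_restrict_of_ae hΨ,
      ae_restrict_of_ae huf] with w hw hΨw huw
    have hwz : ‖w‖ ≤ ‖z‖ + 1 := by
      have h1 := norm_sub_norm_le w z
      rw [Metric.mem_ball, dist_eq_norm] at hw
      linarith
    rw [huw, norm_sq_weighted]
    have h1 : 1 ≤ Real.exp (2 * D) * Real.exp (-2 * Ψ₁ w) := by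
      rw [← Real.exp_add]
      exact Real.one_le_exp (by have := abs_le.1 hΨw; linarith)
    have h2 : 1 ≤ Real.exp (B₀ / 2 * (‖z‖ + 1) ^ 2) * Real.exp (-(B₀ / 2) * ‖w‖ ^ 2) := by
      rw [← Real.exp_add]
      refine Real.one_le_exp ?_
      have : B₀ / 2 * ‖w‖ ^ 2 ≤ B₀ / 2 * (‖z‖ + 1) ^ 2 := by gcongr
      linarith
    calc ‖f w‖ ^ 2 ≤ ((Real.exp (2 * D) * Real.exp (-2 * Ψ₁ w)) *
          (Real.exp (B₀ / 2 * (‖z‖ + 1) ^ 2) * Real.exp (-(B₀ / 2) * ‖w‖ ^ 2))) * ‖f w‖ ^ 2 :=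
          le_mul_of_one_le_left (by positivity) (one_le_mul_of_one_le_of_one_le h1 h2)
      _ = _ := by ring
  rw [integral_const_mul] at hle
  have hle2 : ∫ w in Metric.ball z 1, ‖u w‖ ^ 2 ≤ ‖u‖ ^ 2 := by
    rw [norm_sq_eq_integral]
    exact setIntegral_le_integral hui (Eventually.of_forall fun w => by positivity)
  calc C * ∫ w in Metric.ball z 1, ‖f w‖ ^ 2
      ≤ C * (Real.exp (2 * D) * Real.exp (B₀ / 2 * (‖z‖ + 1) ^ 2) * ‖u‖ ^ 2) := by
        gcongr
        exact hle.trans (by gcongr)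
    _ = _ := by ring

end Fock

/-! ### The operator `P₀ v P₀` -/

section Toeplitz

theorem exp_neg_two_mul_le {x D : ℝ} (h : |x| ≤ D) : Real.exp (-2 * x) ≤ Real.exp (2 * D) := by
  rw [Real.exp_le_exp]
  have := abs_le.1 h
  linarith

/-- A non-negative integrable function which vanishes outside of the disc of radius `R`. -/
structure IsWeight (v : ℂ → ℝ) (R : ℝ) : Prop where
  integrable : Integrable v volume
  nonneg : ∀ᵐ z : ℂ, 0 ≤ v z
  supp : ∀ᵐ z : ℂ, R < ‖z‖ → v z = 0

variable {v : ℂ → ℝ} {R : ℝ}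

theorem IsWeight.integrable_mul (hv : IsWeight v R) {g : ℂ → ℝ} (hg : Continuous g) :
    Integrable fun z => g z * v z := by
  obtain ⟨C, hC⟩ := (isCompact_closedBall (0 : ℂ) R).exists_bound_of_continuousOn hg.continuousOn
  refine Integrable.mono (hv.integrable.const_mul C)
    (hg.aestronglyMeasurable.mul hv.integrable.aestronglyMeasurable) ?_
  filter_upwards [hv.supp] with z hz
  by_cases h : R < ‖z‖
  · simp [hz h]
  · have h1 := hC z (by simpa using h)
    rw [norm_mul, norm_mul]
    gcongr
    exact h1.trans (le_abs_self C)

variable {B₀ : ℝ} {Ψ₁ : Lp ℝ ∞ (volume : Measure ℂ)}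

theorem IsWeight.integrable_mul_norm_sq (hv : IsWeight v R) (hB₀ : 0 ≤ B₀) {u : L2} {f : ℂ → ℂ}
    (hf : Continuous f) (hu : u =ᵐ[volume] weighted B₀ Ψ₁ f) :
    Integrable fun z => v z * ‖u z‖ ^ 2 := by
  obtain ⟨D, hD, hΨ⟩ := exists_ae_abs_le Ψ₁
  refine Integrable.mono ((hv.integrable_mul (g := fun z => ‖f z‖ ^ 2)
    (by fun_prop)).const_mul (Real.exp (2 * D)))
    (hv.integrable.aestronglyMeasurable.mul (integrable_norm_sq u).aestronglyMeasurable) ?_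
  filter_upwards [hΨ, hu] with z hΨz huz
  have h1 := exp_neg_two_mul_le hΨz
  have h2 : Real.exp (-(B₀ / 2) * ‖z‖ ^ 2) ≤ 1 := by
    rw [Real.exp_le_one_iff]
    have : 0 ≤ B₀ / 2 * ‖z‖ ^ 2 := by positivity
    linarith
  simp only [huz, norm_sq_weighted, norm_mul, norm_pow, Real.norm_eq_abs, Real.abs_exp,
    abs_norm]
  calc |v z| * (Real.exp (-2 * Ψ₁ z) * (‖f z‖ ^ 2 * Real.exp (-(B₀ / 2) * ‖z‖ ^ 2)))
      ≤ |v z| * (Real.exp (2 * D) * (‖f z‖ ^ 2 * 1)) := by gcongr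
    _ = _ := by ring

/-- The weighted norm of `e^{-Ψ} p g` is controlled by the supremum of `g` on the disc and by the
weighted norm of the polynomial `p`. -/
theorem IsWeight.integral_mul_norm_sq_le (hv : IsWeight v R) (hB₀ : 0 ≤ B₀) {D : ℝ}
    (hΨ : ∀ᵐ z : ℂ, |Ψ₁ z| ≤ D) {u : L2} {p : ℂ[X]} {g : ℂ → ℂ} (hg : Continuous g)
    (hu : u =ᵐ[volume] weighted B₀ Ψ₁ fun z => p.eval z * g z) {G : ℝ}
    (hG : ∀ z, ‖z‖ ≤ R → ‖g z‖ ^ 2 ≤ G) :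
    ∫ z, v z * ‖u z‖ ^ 2 ≤ Real.exp (2 * D) * G * ∫ z, ‖p.eval z‖ ^ 2 * v z := by
  have hp := p.continuous
  rw [← integral_const_mul]
  refine integral_mono_ae (hv.integrable_mul_norm_sq hB₀ (hp.mul hg) hu)
    ((hv.integrable_mul (g := fun z => ‖p.eval z‖ ^ 2) (by fun_prop)).const_mul _) ?_
  filter_upwards [hΨ, hu, hv.supp, hv.nonneg] with z hΨz huz hs hn
  by_cases h : R < ‖z‖
  · simp [hs h]
  · rw [huz, norm_sq_weighted, norm_mul]
    have h1 := exp_neg_two_mul_le hΨz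
    have h2 : Real.exp (-(B₀ / 2) * ‖z‖ ^ 2) ≤ 1 := by
      rw [Real.exp_le_one_iff]
      have : 0 ≤ B₀ / 2 * ‖z‖ ^ 2 := by positivity
      linarith
    have h3 := hG z (not_lt.1 h)
    calc v z * (Real.exp (-2 * Ψ₁ z) * ((‖p.eval z‖ * ‖g z‖) ^ 2 *
          Real.exp (-(B₀ / 2) * ‖z‖ ^ 2)))
        ≤ v z * (Real.exp (2 * D) * ((‖p.eval z‖ * ‖g z‖) ^ 2 * 1)) := by gcongr
      _ = Real.exp (2 * D) * ‖g z‖ ^ 2 * (‖p.eval z‖ ^ 2 * v z) := by ring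
      _ ≤ Real.exp (2 * D) * G * (‖p.eval z‖ ^ 2 * v z) := by gcongr

theorem P0_mem_ker (u : L2) : P0 B₀ Ψ₁ u ∈ kerPauliPlus B₀ Ψ₁ :=
  Submodule.starProjection_apply_mem _ u

theorem norm_P0_le (u : L2) : ‖P0 B₀ Ψ₁ u‖ ≤ ‖u‖ :=
  Submodule.norm_starProjection_apply_le _ u

variable (B₀ Ψ₁) in
/-- The weighted norm is bounded on `Ker h⁺`. -/
theorem IsWeight.exists_integral_mul_norm_sq_le (hv : IsWeight v R) (hB₀ : 0 ≤ B₀) :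
    ∃ C : ℝ, 0 ≤ C ∧ ∀ u : L2, ∫ z, v z * ‖P0 B₀ Ψ₁ u z‖ ^ 2 ≤ (C * ‖u‖) ^ 2 := by
  obtain ⟨D, -, hΨ⟩ := exists_ae_abs_le Ψ₁
  obtain ⟨A, hA, hpt⟩ := exists_sq_norm_le (Ψ₁ := Ψ₁) hB₀
  have hI : 0 ≤ ∫ z, v z := integral_nonneg_of_ae hv.nonneg
  refine ⟨√(Real.exp (2 * D) * (A * Real.exp (B₀ / 2 * (R + 1) ^ 2)) * ∫ z, v z),
    Real.sqrt_nonneg _, fun u => ?_⟩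
  obtain ⟨f, hf, huf⟩ := exists_entire_of_mem_ker (P0_mem_ker (B₀ := B₀) (Ψ₁ := Ψ₁) u)
  have h1 : ∀ z, ‖z‖ ≤ R → ‖f z‖ ^ 2 ≤ A * Real.exp (B₀ / 2 * (R + 1) ^ 2) * ‖u‖ ^ 2 := by
    intro z hz
    refine (hpt _ f hf huf z).trans ?_
    gcongr
    exact norm_P0_le u
  have h2 := hv.integral_mul_norm_sq_le hB₀ hΨ (p := 1) hf.continuous
    (by simpa using huf) h1
  rw [mul_pow, Real.sq_sqrt (by positivity)]
  simp only [Polynomial.eval_one, norm_one, one_pow, one_mul] at h2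
  exact h2.trans (le_of_eq (by ring))

theorem IsWeight.memLp_sqrt_mul (hv : IsWeight v R) (hB₀ : 0 ≤ B₀) (u : L2) :
    MemLp (fun z => (√(v z) : ℂ) * P0 B₀ Ψ₁ u z) 2 volume := by
  have hm : AEStronglyMeasurable (fun z => (√(v z) : ℂ) * P0 B₀ Ψ₁ u z) volume :=
    ((by fun_prop : Continuous fun x : ℝ => (√x : ℂ)).comp_aestronglyMeasurable
      hv.integrable.aestronglyMeasurable).mul (Lp.aestronglyMeasurable _)
  rw [memLp_two_iff_integrable_sq_norm hm]
  obtain ⟨f, hf, huf⟩ := exists_entire_of_mem_ker (P0_mem_ker (B₀ := B₀) (Ψ₁ := Ψ₁) u)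
  refine (hv.integrable_mul_norm_sq hB₀ hf.continuous huf).congr ?_
  filter_upwards [hv.nonneg] with z hz
  rw [norm_mul, mul_pow, Complex.norm_real, Real.norm_eq_abs, sq_abs, Real.sq_sqrt hz]

theorem IsWeight.norm_sq_toLp (hv : IsWeight v R) (hB₀ : 0 ≤ B₀) (u : L2) :
    ‖(hv.memLp_sqrt_mul (Ψ₁ := Ψ₁) hB₀ u).toLp _‖ ^ 2 = ∫ z, v z * ‖P0 B₀ Ψ₁ u z‖ ^ 2 := by
  rw [norm_sq_eq_integral]
  refine integral_congr_ae ?_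
  filter_upwards [hv.nonneg, (hv.memLp_sqrt_mul (Ψ₁ := Ψ₁) hB₀ u).coeFn_toLp] with z hz h
  rw [h, norm_mul, mul_pow, Complex.norm_real, Real.norm_eq_abs, sq_abs, Real.sq_sqrt hz]

variable (Ψ₁) in
/-- The bounded operator `√v P₀`. -/
theorem IsWeight.exists_sqrt_mul_P0 (hv : IsWeight v R) (hB₀ : 0 ≤ B₀) :
    ∃ J : L2 →L[ℂ] L2, ∀ u, J u =ᵐ[volume] fun z => (√(v z) : ℂ) * P0 B₀ Ψ₁ u z := by
  obtain ⟨C, hC, hbound⟩ := hv.exists_integral_mul_norm_sq_le B₀ Ψ₁ hB₀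
  let J₀ : L2 →ₗ[ℂ] L2 :=
    { toFun := fun u => (hv.memLp_sqrt_mul (Ψ₁ := Ψ₁) hB₀ u).toLp _
      map_add' := fun u w => by
        refine Lp.ext ?_
        have h4 : P0 B₀ Ψ₁ (u + w) =ᵐ[volume] P0 B₀ Ψ₁ u + P0 B₀ Ψ₁ w := by
          rw [map_add]
          exact Lp.coeFn_add _ _
        filter_upwards [(hv.memLp_sqrt_mul (Ψ₁ := Ψ₁) hB₀ u).coeFn_toLp,
          (hv.memLp_sqrt_mul (Ψ₁ := Ψ₁) hB₀ w).coeFn_toLp,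
          (hv.memLp_sqrt_mul (Ψ₁ := Ψ₁) hB₀ (u + w)).coeFn_toLp, h4,
          Lp.coeFn_add ((hv.memLp_sqrt_mul (Ψ₁ := Ψ₁) hB₀ u).toLp _)
            ((hv.memLp_sqrt_mul (Ψ₁ := Ψ₁) hB₀ w).toLp _)] with z h1 h2 h3 h4 h5
        rw [h5, Pi.add_apply, h1, h2, h3, h4, Pi.add_apply, mul_add]
      map_smul' := fun c u => by
        refine Lp.ext ?_
        have h4 : P0 B₀ Ψ₁ (c • u) =ᵐ[volume] c • P0 B₀ Ψ₁ u := by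
          rw [map_smul]
          exact Lp.coeFn_smul _ _
        filter_upwards [(hv.memLp_sqrt_mul (Ψ₁ := Ψ₁) hB₀ u).coeFn_toLp,
          (hv.memLp_sqrt_mul (Ψ₁ := Ψ₁) hB₀ (c • u)).coeFn_toLp, h4,
          Lp.coeFn_smul c ((hv.memLp_sqrt_mul (Ψ₁ := Ψ₁) hB₀ u).toLp _)] with z h1 h3 h4 h5
        rw [RingHom.id_apply, h5, Pi.smul_apply, h1, h3, h4, Pi.smul_apply, smul_eq_mul,
          smul_eq_mul]
        ring }
  refine ⟨J₀.mkContinuous C fun u => ?_, fun u => ?_⟩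
  · refine abs_le_of_sq_le_sq' ?_ (by positivity) |>.2
    exact (hv.norm_sq_toLp hB₀ u).trans_le (hbound u)
  · exact (hv.memLp_sqrt_mul (Ψ₁ := Ψ₁) hB₀ u).coeFn_toLp

/-- `T = (√v P₀)* (√v P₀)` is the operator `P₀ v P₀`. -/
theorem IsWeight.exists_isP0vP0 (hv : IsWeight v R) (hB₀ : 0 ≤ B₀) :
    ∃ J : L2 →L[ℂ] L2, (∀ u, ‖J u‖ ^ 2 = ∫ z, v z * ‖P0 B₀ Ψ₁ u z‖ ^ 2) ∧
      IsP0vP0 B₀ Ψ₁ v (J.adjoint ∘L J) := by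
  obtain ⟨J, hJ⟩ := hv.exists_sqrt_mul_P0 Ψ₁ hB₀
  refine ⟨J, fun u => ?_, fun u w => ?_⟩
  · rw [norm_sq_eq_integral]
    refine integral_congr_ae ?_
    filter_upwards [hv.nonneg, hJ u] with z hz h
    rw [h, norm_mul, mul_pow, Complex.norm_real, Real.norm_eq_abs, sq_abs, Real.sq_sqrt hz]
  · have heq : (fun z => inner ℂ (J u z) (J w z)) =ᵐ[volume]
        fun z => (v z : ℂ) * (conj (P0 B₀ Ψ₁ u z) * P0 B₀ Ψ₁ w z) := by
      filter_upwards [hv.nonneg, hJ u, hJ w] with z hz hu hw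
      have hsq : (√(v z) : ℂ) * (√(v z) : ℂ) = (v z : ℂ) := by
        rw [← Complex.ofReal_mul, Real.mul_self_sqrt hz]
      rw [hu, hw, RCLike.inner_apply, map_mul, Complex.conj_ofReal, ← hsq]
      ring
    refine ⟨(L2.integrable_inner (J u) (J w)).congr heq, ?_⟩
    rw [ContinuousLinearMap.comp_apply, ContinuousLinearMap.adjoint_inner_right, L2.inner_def]
    exact integral_congr_ae heq

theorem IsP0vP0.unique {T T' : L2 →L[ℂ] L2} (hT : IsP0vP0 B₀ Ψ₁ v T) (hT' : IsP0vP0 B₀ Ψ₁ v T') :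
    T' = T := by
  ext1 w
  refine ext_inner_left ℂ fun u => ?_
  rw [(hT u w).2, (hT' u w).2]

end Toeplitz

/-! ### Bounds for the quadratic form -/

section Bounds

variable {v : ℂ → ℝ} {R : ℝ} {B₀ : ℝ} {Ψ₁ : Lp ℝ ∞ (volume : Measure ℂ)}

variable (B₀ Ψ₁) in
/-- The functions `u` for which `P₀ u = e^{-Ψ} p g`, where `g` is entire and `p` is the monic
polynomial with the roots `S`. -/
noncomputable def divisibleBy (S : Multiset ℂ) : Submodule ℂ L2 where
  carrier := {u | ∃ g : ℂ → ℂ, Differentiable ℂ g ∧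
    P0 B₀ Ψ₁ u =ᵐ[volume] weighted B₀ Ψ₁ fun z => (rootPoly S).eval z * g z}
  zero_mem' := by
    refine ⟨0, differentiable_const 0, ?_⟩
    rw [map_zero]
    filter_upwards [Lp.coeFn_zero ℂ 2 (volume : Measure ℂ)] with z hz
    rw [hz]
    simp [weighted]
  add_mem' := by
    rintro u w ⟨f, hf, hu⟩ ⟨g, hg, hw⟩
    refine ⟨fun z => f z + g z, hf.add hg, ?_⟩
    rw [map_add]
    filter_upwards [hu, hw, Lp.coeFn_add (P0 B₀ Ψ₁ u) (P0 B₀ Ψ₁ w)] with z h1 h2 h3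
    rw [h3, Pi.add_apply, h1, h2]
    simp only [weighted]
    ring
  smul_mem' := by
    rintro c u ⟨f, hf, hu⟩
    refine ⟨fun z => c * f z, hf.const_mul c, ?_⟩
    rw [map_smul]
    filter_upwards [hu, Lp.coeFn_smul c (P0 B₀ Ψ₁ u)] with z h1 h3
    rw [h3, Pi.smul_apply, h1, smul_eq_mul]
    simp only [weighted]
    ring

/-- Divisibility by a polynomial of degree `n` imposes at most `n` linear conditions: the remainders
of `n + 1` functions are linearly dependent. -/
theorem codimLE_divisibleBy (S : Multiset ℂ) : CodimLE (divisibleBy B₀ Ψ₁ S) S.card := by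
  intro V hV
  have hfd : FiniteDimensional ℂ V := Module.finite_of_finrank_pos (by omega)
  let b := Module.finBasisOfFinrankEq ℂ V hV
  have h1 : ∀ i, ∃ f : ℂ → ℂ, Differentiable ℂ f ∧
      P0 B₀ Ψ₁ (b i) =ᵐ[volume] weighted B₀ Ψ₁ f := fun i =>
    exists_entire_of_mem_ker (P0_mem_ker _)
  choose f hf hbf using h1
  have h2 := fun i => exists_eq_rootPoly_mul_add S (hf i)
  choose g hg r hr hfgr using h2
  have hfin : Module.finrank ℂ (Polynomial.degreeLT ℂ S.card) = S.card := by
    rw [(Polynomial.degreeLTEquiv ℂ S.card).finrank_eq, Module.finrank_fin_fun]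
  have hfdP : FiniteDimensional ℂ (Polynomial.degreeLT ℂ S.card) :=
    Module.Finite.equiv (Polynomial.degreeLTEquiv ℂ S.card).symm
  have hdep : ¬ LinearIndependent ℂ fun i => (⟨r i, hr i⟩ : Polynomial.degreeLT ℂ S.card) := by
    intro h
    have := h.fintype_card_le_finrank
    rw [hfin, Fintype.card_fin] at this
    omega
  obtain ⟨c, hc, i, hci⟩ := Fintype.not_linearIndependent_iff.1 hdep
  have hc' : ∑ i, c i • r i = 0 := by
    have := congrArg Subtype.val hc
    simpa using this
  refine ⟨∑ i, c i • (b i : L2), Submodule.sum_mem _ fun i _ => Submodule.smul_mem _ _ (b i).2,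
    ⟨fun z => ∑ i, c i * g i z, ?_, ?_⟩, fun h0 => ?_⟩
  · exact Differentiable.fun_sum fun i _ => (hg i).const_mul (c i)
  · have h3 : ∀ᵐ z, P0 B₀ Ψ₁ (∑ i, c i • (b i : L2)) z = ∑ i, c i * P0 B₀ Ψ₁ (b i) z := by
      rw [map_sum]
      filter_upwards [Lp.coeFn_finsetSum Finset.univ (fun i => P0 B₀ Ψ₁ (c i • (b i : L2))),
        ae_all_iff.2 fun i => Lp.coeFn_smul (c i) (P0 B₀ Ψ₁ (b i))] with z h4 h5
      rw [h4, Finset.sum_apply]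
      refine Finset.sum_congr rfl fun i _ => ?_
      rw [map_smul, h5, Pi.smul_apply, smul_eq_mul]
    filter_upwards [h3, ae_all_iff.2 hbf] with z h4 h5
    rw [h4]
    have h6 : ∑ i, c i * (r i).eval z = 0 := by
      have := congrArg (Polynomial.eval z) hc'
      simpa [Polynomial.eval_finsetSum] using this
    simp only [weighted] at h5 ⊢
    calc ∑ i, c i * P0 B₀ Ψ₁ (b i) z
        = ∑ i, ((Real.exp (-potential B₀ Ψ₁ z) : ℂ) * ((rootPoly S).eval z * (c i * g i z)) +
            (Real.exp (-potential B₀ Ψ₁ z) : ℂ) * (c i * (r i).eval z)) :=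
          Finset.sum_congr rfl fun i _ => by
            rw [h5, hfgr]
            ring
      _ = _ := by
          rw [Finset.sum_add_distrib, ← Finset.mul_sum, ← Finset.mul_sum, ← Finset.mul_sum, h6,
            mul_zero, add_zero]
  · have h7 : ∑ i, c i • b i = 0 := by
      refine Subtype.ext ?_
      simpa using h0
    exact hci (Fintype.linearIndependent_iff.1 b.linearIndependent c h7 i)

variable (Ψ₁) in
/-- On the functions divisible by a polynomial `p` with roots in the disc of radius `2R`, the
weighted norm is controlled by that of `p`: the quotient is estimated on a circle of radius `ρ`. -/
theorem IsWeight.exists_upper_bound (hv : IsWeight v R) (hR : 0 < R) (hB₀ : 0 ≤ B₀) :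
    ∃ C : ℝ, 0 < C ∧ ∀ S : Multiset ℂ, (∀ a ∈ S, ‖a‖ ≤ 2 * R) → ∀ ρ : ℝ, 2 * R < ρ →
      ∀ u ∈ divisibleBy B₀ Ψ₁ S, ∫ z, v z * ‖P0 B₀ Ψ₁ u z‖ ^ 2 ≤
        C * Real.exp (B₀ / 2 * (ρ + 1) ^ 2) / ((ρ - 2 * R) ^ S.card) ^ 2 *
          (∫ z, ‖(rootPoly S).eval z‖ ^ 2 * v z) * ‖u‖ ^ 2 := by
  obtain ⟨D, -, hΨ⟩ := exists_ae_abs_le Ψ₁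
  obtain ⟨A, hA, hpt⟩ := exists_sq_norm_le (Ψ₁ := Ψ₁) hB₀
  refine ⟨Real.exp (2 * D) * A, by positivity, fun S hS ρ hρ u hu => ?_⟩
  obtain ⟨g, hg, hug⟩ := hu
  have hpg : Differentiable ℂ fun z => (rootPoly S).eval z * g z :=
    (rootPoly S).differentiable.mul hg
  have hpos : 0 < (ρ - 2 * R) ^ S.card := pow_pos (by linarith) _
  set X := A * Real.exp (B₀ / 2 * (ρ + 1) ^ 2) * ‖u‖ ^ 2 with hX
  have hX0 : 0 ≤ X := by positivity
  have h1 : ∀ z, ‖z‖ = ρ → ‖(rootPoly S).eval z * g z‖ ≤ √X := by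
    intro z hz
    refine Real.le_sqrt_of_sq_le ((hpt _ _ hpg hug z).trans ?_)
    rw [hX, hz]
    gcongr
    exact norm_P0_le u
  have h2 : ∀ z, ‖z‖ ≤ R → ‖g z‖ ^ 2 ≤ X / ((ρ - 2 * R) ^ S.card) ^ 2 := by
    intro z hz
    have := norm_quotient_le (by linarith) hρ S hS hg h1 (z := z) (by linarith)
    calc ‖g z‖ ^ 2 ≤ (√X / (ρ - 2 * R) ^ S.card) ^ 2 := by gcongr
      _ = _ := by rw [div_pow, Real.sq_sqrt hX0]
  refine (hv.integral_mul_norm_sq_le hB₀ hΨ hg.continuous hug h2).trans (le_of_eq ?_)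
  rw [hX]
  ring

/-- `M_n(v)` is a lower bound for the weighted norms of monic polynomials. -/
theorem IsWeight.M_le (hv : IsWeight v R) {p : ℂ[X]} (hp : p.Monic) :
    M p.natDegree v ≤ ∫ z, ‖p.eval z‖ ^ 2 * v z := by
  refine csInf_le ⟨0, ?_⟩ ⟨p, hp, rfl, rfl⟩
  rintro _ ⟨q, -, -, rfl⟩
  refine integral_nonneg_of_ae ?_
  filter_upwards [hv.nonneg] with z hz
  positivity

theorem le_M {n : ℕ} {c : ℝ} (h : ∀ p : ℂ[X], p.Monic → p.natDegree = n →
    c ≤ ∫ z, ‖p.eval z‖ ^ 2 * v z) : c ≤ M n v := by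
  refine le_csInf ⟨_, Polynomial.X ^ n, Polynomial.monic_X_pow n, by simp, rfl⟩ ?_
  rintro _ ⟨p, hp, hn, rfl⟩
  exact h p hp hn

theorem IsWeight.integral_mono (hv : IsWeight v R) {f g : ℂ → ℝ} (hf : Continuous f)
    (hg : Continuous g) (h : ∀ z, ‖z‖ ≤ R → f z ≤ g z) :
    ∫ z, f z * v z ≤ ∫ z, g z * v z := by
  refine integral_mono_ae (hv.integrable_mul hf) (hv.integrable_mul hg) ?_
  filter_upwards [hv.nonneg, hv.supp] with z hz hs
  by_cases hzR : R < ‖z‖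
  · simp [hs hzR]
  · exact mul_le_mul_of_nonneg_right (h z (not_lt.1 hzR)) hz

/-- The integral `∫ (|z| + 2R)^{2n} e^{-B₀|z|²/2}`, which dominates the squared Gaussian norm of
a monic polynomial of degree `n` with roots in the disc of radius `2R`. -/
noncomputable def gaussMoment (B₀ R : ℝ) (n : ℕ) : ℝ :=
  ∫ z : ℂ, ((‖z‖ + 2 * R) ^ n) ^ 2 * Real.exp (-(B₀ / 2) * ‖z‖ ^ 2)

theorem integrable_exp_neg_mul_norm_sq {b : ℝ} (hb : 0 < b) :
    Integrable fun z : ℂ => Real.exp (-b * ‖z‖ ^ 2) := by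
  have h := GaussianFourier.integrable_cexp_neg_mul_sq_norm_add (V := ℂ) (b := (b : ℂ))
    (by simpa using hb) 0 0
  refine h.norm.congr (Eventually.of_forall fun z => ?_)
  simp only [Complex.norm_exp]
  norm_cast
  simp

/-- From `x^n ≤ n! t^{-n} e^{t x}` with `x = (|z| + 2R)²`: the Gaussian still dominates `e^{t x}` as
long as `t < B₀ / 2`. -/
theorem exists_gaussian_bound {t : ℝ} (ht : 0 < t) (htB : t < B₀ / 2) :
    ∃ g : ℂ → ℝ, Integrable g ∧ ∀ (n : ℕ) (z : ℂ), ((‖z‖ + 2 * R) ^ n) ^ 2 *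
      Real.exp (-(B₀ / 2) * ‖z‖ ^ 2) ≤ n.factorial * (t ^ n)⁻¹ * g z := by
  -- `t (|z| + 2R)² ≤ τ |z|² + K` where `τ` lies between `t` and `B₀ / 2`.
  set τ := (t + B₀ / 2) / 2 with hτ
  have hτt : 0 < τ - t := by rw [hτ]; linarith
  set K := τ * t / (τ - t) * (2 * R) ^ 2 with hK
  refine ⟨fun z => Real.exp K * Real.exp (-(B₀ / 2 - τ) * ‖z‖ ^ 2),
    (integrable_exp_neg_mul_norm_sq (by rw [hτ]; linarith)).const_mul _, fun n z => ?_⟩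
  have h1 : t * (‖z‖ + 2 * R) ^ 2 ≤ τ * ‖z‖ ^ 2 + K := by
    have h2 : τ * ‖z‖ ^ 2 + K - t * (‖z‖ + 2 * R) ^ 2 =
        ((τ - t) * ‖z‖ - t * (2 * R)) ^ 2 / (τ - t) := by
      rw [hK]
      field_simp
      ring
    have : 0 ≤ ((τ - t) * ‖z‖ - t * (2 * R)) ^ 2 / (τ - t) := by positivity
    linarith
  have h3 := Real.pow_div_factorial_le_exp (t * (‖z‖ + 2 * R) ^ 2) (by positivity) n
  rw [div_le_iff₀ (by positivity), mul_pow] at h3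
  have h4 : ((‖z‖ + 2 * R) ^ n) ^ 2 ≤
      n.factorial * (t ^ n)⁻¹ * Real.exp (t * (‖z‖ + 2 * R) ^ 2) := by
    rw [← pow_mul, mul_comm n 2, pow_mul]
    calc ((‖z‖ + 2 * R) ^ 2) ^ n = (t ^ n * ((‖z‖ + 2 * R) ^ 2) ^ n) * (t ^ n)⁻¹ := by
          field_simp
      _ ≤ (Real.exp (t * (‖z‖ + 2 * R) ^ 2) * n.factorial) * (t ^ n)⁻¹ := by gcongr
      _ = _ := by ring
  calc ((‖z‖ + 2 * R) ^ n) ^ 2 * Real.exp (-(B₀ / 2) * ‖z‖ ^ 2)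
      ≤ (n.factorial * (t ^ n)⁻¹ * Real.exp (τ * ‖z‖ ^ 2 + K)) *
        Real.exp (-(B₀ / 2) * ‖z‖ ^ 2) := by
        gcongr
        exact h4.trans (by gcongr)
    _ = _ := by
        simp only
        rw [mul_assoc, ← Real.exp_add, ← Real.exp_add]
        congr 2
        ring

theorem integrable_gaussMoment (hB₀ : 0 < B₀) (n : ℕ) : Integrable fun z : ℂ =>
    ((‖z‖ + 2 * R) ^ n) ^ 2 * Real.exp (-(B₀ / 2) * ‖z‖ ^ 2) := by
  obtain ⟨g, hg, h⟩ := exists_gaussian_bound (B₀ := B₀) (R := R) (t := B₀ / 4) (by positivity)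
    (by linarith)
  refine Integrable.mono' (hg.const_mul (n.factorial * ((B₀ / 4) ^ n)⁻¹)) ?_ (Eventually.of_forall fun z => ?_)
  · exact Continuous.aestronglyMeasurable (by fun_prop)
  · rw [Real.norm_of_nonneg (by positivity)]
    exact h n z

theorem exists_gaussMoment_le {t : ℝ} (ht : 0 < t) (htB : t < B₀ / 2) :
    ∃ C : ℝ, 0 < C ∧ ∀ n : ℕ, gaussMoment B₀ R n ≤ n.factorial * (t ^ n)⁻¹ * C := by
  obtain ⟨g, hg, h⟩ := exists_gaussian_bound (B₀ := B₀) (R := R) ht htB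
  refine ⟨max (∫ z, g z) 1, by positivity, fun n => ?_⟩
  refine (integral_mono (integrable_gaussMoment (by linarith) n) (hg.const_mul _) (h n)).trans ?_
  rw [integral_const_mul]
  gcongr
  exact le_max_left _ _

theorem gaussMoment_pos (hB₀ : 0 < B₀) (hR : 0 < R) (n : ℕ) : 0 < gaussMoment B₀ R n := by
  refine integral_pos_of_integrable_nonneg_nonzero (x := 0) (by fun_prop)
    (integrable_gaussMoment hB₀ n) (fun z => by positivity) ?_
  positivity

/-- The comparison of the two norms of a polynomial. Roots far away from the support of `v` affect
both norms by the same factor, and lowering the degree below `n` is compensated by powers of `z`. -/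
theorem IsWeight.M_mul_integral_le (hv : IsWeight v R) (hR : 0 < R) (hB₀ : 0 < B₀) {n : ℕ} {p : ℂ[X]}
    (hp : p.natDegree ≤ n) :
    M n v * ∫ z, ‖p.eval z‖ ^ 2 * Real.exp (-(B₀ / 2) * ‖z‖ ^ 2) ≤
      gaussMoment B₀ R n * ∫ z, ‖p.eval z‖ ^ 2 * v z := by
  obtain ⟨S', hS', -, A, hA, hlow, hup⟩ := exists_moved_roots hR p.roots
  have hA0 : 0 < A := by linarith
  rw [card_roots_eq] at hS' hup
  set k := p.natDegree with hk
  set c := ‖p.leadingCoeff‖ with hc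
  have hpe : ∀ z, ‖p.eval z‖ = c * ‖(rootPoly p.roots).eval z‖ := by
    intro z
    conv_lhs => rw [eq_C_mul_rootPoly p]
    rw [Polynomial.eval_mul, Polynomial.eval_C, norm_mul]
  have hM0 : 0 ≤ M n v := by
    refine Real.sInf_nonneg ?_
    rintro _ ⟨q, -, -, rfl⟩
    refine integral_nonneg_of_ae ?_
    filter_upwards [hv.nonneg] with z hz
    positivity
  -- The weighted norm from below.
  have h1 : M n v ≤ (R ^ (n - k)) ^ 2 * ∫ z, ‖(rootPoly S').eval z‖ ^ 2 * v z := by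
    have hmon : (rootPoly S' * Polynomial.X ^ (n - k)).Monic :=
      (rootPoly_monic S').mul (Polynomial.monic_X_pow _)
    have hdeg : (rootPoly S' * Polynomial.X ^ (n - k)).natDegree = n := by
      rw [(rootPoly_monic S').natDegree_mul (Polynomial.monic_X_pow _), natDegree_rootPoly, hS',
        Polynomial.natDegree_X_pow]
      omega
    have := hv.M_le hmon
    rw [hdeg] at this
    refine this.trans ?_
    rw [← integral_const_mul]
    simp_rw [← mul_assoc]
    refine hv.integral_mono (by fun_prop) (by fun_prop) fun z hz => ?_
    rw [Polynomial.eval_mul, norm_mul, Polynomial.eval_pow, Polynomial.eval_X, norm_pow, mul_pow,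
      mul_comm]
    gcongr
  have h2 : c ^ 2 * A ^ 2 * ∫ z, ‖(rootPoly S').eval z‖ ^ 2 * v z ≤
      ∫ z, ‖p.eval z‖ ^ 2 * v z := by
    rw [← integral_const_mul]
    simp_rw [← mul_assoc]
    refine hv.integral_mono (by fun_prop) (by fun_prop) fun z hz => ?_
    rw [hpe, mul_assoc, ← mul_pow, ← mul_pow]
    gcongr
    exact hlow z hz
  -- The Gaussian norm from above.
  have h3 : (R ^ (n - k)) ^ 2 * ∫ z, ‖p.eval z‖ ^ 2 * Real.exp (-(B₀ / 2) * ‖z‖ ^ 2) ≤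
      c ^ 2 * A ^ 2 * gaussMoment B₀ R n := by
    rw [gaussMoment, ← integral_const_mul, ← integral_const_mul]
    refine integral_mono_of_nonneg (Eventually.of_forall fun z => by positivity)
      ((integrable_gaussMoment hB₀ n).const_mul _) (Eventually.of_forall fun z => ?_)
    simp only
    have h4 : R ^ (n - k) * ‖p.eval z‖ ≤ c * A * (‖z‖ + 2 * R) ^ n := by
      have h5 : R ^ (n - k) ≤ (‖z‖ + 2 * R) ^ (n - k) := by
        gcongr
        have := norm_nonneg z
        linarith
      calc R ^ (n - k) * ‖p.eval z‖
          ≤ (‖z‖ + 2 * R) ^ (n - k) * (c * (A * (‖z‖ + 2 * R) ^ k)) := by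
            rw [hpe]
            gcongr
            exact hup z
        _ = c * A * ((‖z‖ + 2 * R) ^ (n - k) * (‖z‖ + 2 * R) ^ k) := by ring
        _ = _ := by rw [← pow_add, Nat.sub_add_cancel hp]
    calc (R ^ (n - k)) ^ 2 * (‖p.eval z‖ ^ 2 * Real.exp (-(B₀ / 2) * ‖z‖ ^ 2))
        = (R ^ (n - k) * ‖p.eval z‖) ^ 2 * Real.exp (-(B₀ / 2) * ‖z‖ ^ 2) := by ring
      _ ≤ (c * A * (‖z‖ + 2 * R) ^ n) ^ 2 * Real.exp (-(B₀ / 2) * ‖z‖ ^ 2) := by gcongr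
      _ = _ := by ring
  have hI : 0 ≤ ∫ z, ‖p.eval z‖ ^ 2 * Real.exp (-(B₀ / 2) * ‖z‖ ^ 2) :=
    integral_nonneg fun z => by positivity
  have hI' : 0 ≤ ∫ z, ‖(rootPoly S').eval z‖ ^ 2 * v z := by
    refine integral_nonneg_of_ae ?_
    filter_upwards [hv.nonneg] with z hz
    positivity
  have hg := gaussMoment_pos hB₀ hR n
  calc M n v * ∫ z, ‖p.eval z‖ ^ 2 * Real.exp (-(B₀ / 2) * ‖z‖ ^ 2)
      ≤ ((R ^ (n - k)) ^ 2 * ∫ z, ‖(rootPoly S').eval z‖ ^ 2 * v z) *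
        ∫ z, ‖p.eval z‖ ^ 2 * Real.exp (-(B₀ / 2) * ‖z‖ ^ 2) := by gcongr
    _ = ((R ^ (n - k)) ^ 2 * ∫ z, ‖p.eval z‖ ^ 2 * Real.exp (-(B₀ / 2) * ‖z‖ ^ 2)) *
        ∫ z, ‖(rootPoly S').eval z‖ ^ 2 * v z := by ring
    _ ≤ (c ^ 2 * A ^ 2 * gaussMoment B₀ R n) * ∫ z, ‖(rootPoly S').eval z‖ ^ 2 * v z := by gcongr
    _ = gaussMoment B₀ R n * (c ^ 2 * A ^ 2 * ∫ z, ‖(rootPoly S').eval z‖ ^ 2 * v z) := by ring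
    _ ≤ _ := by gcongr

end Bounds

/-! ### Polynomials in the kernel -/

section Polynomials

variable {v : ℂ → ℝ} {R : ℝ} {B₀ : ℝ} {Ψ₁ : Lp ℝ ∞ (volume : Measure ℂ)}

theorem integrable_norm_sq_polynomial (hB₀ : 0 < B₀) (p : ℂ[X]) :
    Integrable fun z => ‖p.eval z‖ ^ 2 * Real.exp (-(B₀ / 2) * ‖z‖ ^ 2) := by
  obtain ⟨-, -, -, A, hA, -, hup⟩ := exists_moved_roots one_pos p.roots
  have hp := p.continuous
  refine Integrable.mono' ((integrable_gaussMoment (R := 1) hB₀ p.roots.card).const_mul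
    ((‖p.leadingCoeff‖ * A) ^ 2)) (Continuous.aestronglyMeasurable (by fun_prop))
    (Eventually.of_forall fun z => ?_)
  rw [Real.norm_of_nonneg (by positivity), ← mul_assoc, ← mul_pow]
  gcongr
  conv_lhs => rw [eq_C_mul_rootPoly p]
  rw [Polynomial.eval_mul, Polynomial.eval_C, norm_mul, mul_assoc]
  gcongr
  exact hup z

theorem memLp_weighted_polynomial (hB₀ : 0 < B₀) (p : ℂ[X]) :
    MemLp (weighted B₀ Ψ₁ fun z => p.eval z) 2 volume := by
  have hm := aestronglyMeasurable_weighted (B₀ := B₀) (Ψ₁ := Ψ₁) p.continuous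
  rw [memLp_two_iff_integrable_sq_norm hm]
  obtain ⟨D, -, hΨ⟩ := exists_ae_abs_le Ψ₁
  refine Integrable.mono' ((integrable_norm_sq_polynomial hB₀ p).const_mul (Real.exp (2 * D)))
    (hm.norm.pow 2) ?_
  filter_upwards [hΨ] with z hz
  rw [Real.norm_of_nonneg (by positivity), norm_sq_weighted]
  exact mul_le_mul_of_nonneg_right (exp_neg_two_mul_le hz) (by positivity)

variable (Ψ₁) in
/-- The embedding `p ↦ e^{-Ψ} p` of the polynomials into `Ker h⁺`. -/
noncomputable def polyEmbedding (hB₀ : 0 < B₀) : ℂ[X] →ₗ[ℂ] L2 where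
  toFun p := (memLp_weighted_polynomial (Ψ₁ := Ψ₁) hB₀ p).toLp _
  map_add' p q := by
    refine Lp.ext ?_
    filter_upwards [(memLp_weighted_polynomial (Ψ₁ := Ψ₁) hB₀ p).coeFn_toLp,
      (memLp_weighted_polynomial (Ψ₁ := Ψ₁) hB₀ q).coeFn_toLp,
      (memLp_weighted_polynomial (Ψ₁ := Ψ₁) hB₀ (p + q)).coeFn_toLp,
      Lp.coeFn_add ((memLp_weighted_polynomial (Ψ₁ := Ψ₁) hB₀ p).toLp _)
        ((memLp_weighted_polynomial (Ψ₁ := Ψ₁) hB₀ q).toLp _)] with z h1 h2 h3 h4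
    rw [h4, Pi.add_apply, h1, h2, h3]
    simp [weighted, mul_add]
  map_smul' c p := by
    refine Lp.ext ?_
    filter_upwards [(memLp_weighted_polynomial (Ψ₁ := Ψ₁) hB₀ p).coeFn_toLp,
      (memLp_weighted_polynomial (Ψ₁ := Ψ₁) hB₀ (c • p)).coeFn_toLp,
      Lp.coeFn_smul c ((memLp_weighted_polynomial (Ψ₁ := Ψ₁) hB₀ p).toLp _)] with z h1 h2 h3
    rw [RingHom.id_apply, h3, Pi.smul_apply, h1, h2]
    simp only [weighted, Polynomial.eval_smul, smul_eq_mul]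
    ring

theorem polyEmbedding_ae (hB₀ : 0 < B₀) (p : ℂ[X]) :
    polyEmbedding Ψ₁ hB₀ p =ᵐ[volume] weighted B₀ Ψ₁ fun z => p.eval z :=
  (memLp_weighted_polynomial (Ψ₁ := Ψ₁) hB₀ p).coeFn_toLp

theorem P0_polyEmbedding (hB₀ : 0 < B₀) (p : ℂ[X]) :
    P0 B₀ Ψ₁ (polyEmbedding Ψ₁ hB₀ p) = polyEmbedding Ψ₁ hB₀ p :=
  Submodule.starProjection_eq_self_iff.2 
    (toLp_mem_ker p.differentiable (memLp_weighted_polynomial hB₀ p))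

theorem polyEmbedding_injective (hB₀ : 0 < B₀) :
    Function.Injective (polyEmbedding Ψ₁ hB₀) := by
  rw [← LinearMap.ker_eq_bot, LinearMap.ker_eq_bot']
  intro p hp
  have h1 : (fun z => p.eval z) =ᵐ[volume] fun _ => (0 : ℂ) := by
    have h2 : polyEmbedding Ψ₁ hB₀ p =ᵐ[volume] 0 := by
      rw [hp]
      exact Lp.coeFn_zero _ _ _
    filter_upwards [polyEmbedding_ae (Ψ₁ := Ψ₁) hB₀ p, h2] with z h3 h4
    rw [h4, Pi.zero_apply, weighted] at h3
    simpa using h3.symm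
  rw [Continuous.ae_eq_iff_eq volume p.continuous continuous_const] at h1
  exact Polynomial.funext fun z => by simpa using congrFun h1 z

theorem finrank_map_polyEmbedding (hB₀ : 0 < B₀) (n : ℕ) : Module.finrank ℂ
    ((Polynomial.degreeLT ℂ n).map (polyEmbedding Ψ₁ hB₀)) = n := by
  rw [← (Submodule.equivMapOfInjective _ (polyEmbedding_injective hB₀) _).finrank_eq,
    (Polynomial.degreeLTEquiv ℂ n).finrank_eq, Module.finrank_fin_fun]

/-- A non-zero polynomial has a positive weighted norm, as it vanishes at finitely many points. -/
theorem IsWeight.integral_polynomial_pos (hv : IsWeight v R) (hv0 : ¬ v =ᵐ[volume] 0) {p : ℂ[X]}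
    (hp : p ≠ 0) : 0 < ∫ z, ‖p.eval z‖ ^ 2 * v z := by
  have hpc := p.continuous
  have hnn : 0 ≤ᵐ[volume] fun z => ‖p.eval z‖ ^ 2 * v z := by
    filter_upwards [hv.nonneg] with z hz
    exact mul_nonneg (by positivity) hz
  refine lt_of_le_of_ne (integral_nonneg_of_ae hnn) fun h => hv0 ?_
  rw [eq_comm, integral_eq_zero_iff_of_nonneg_ae hnn
    (hv.integrable_mul (g := fun z => ‖p.eval z‖ ^ 2) (by fun_prop))] at h
  have hfin : {z | p.eval z = 0}.Finite := by
    refine (p.roots.toFinset.finite_toSet).subset fun z hz => ?_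
    simpa [hp] using hz
  have hae : ∀ᵐ z : ℂ, p.eval z ≠ 0 := by
    rw [ae_iff]
    simpa using hfin.measure_zero volume
  filter_upwards [h, hae] with z h1 h2
  simpa [h2] using h1

theorem norm_sq_polyEmbedding_le (hB₀ : 0 < B₀) {D : ℝ} (hΨ : ∀ᵐ z : ℂ, |Ψ₁ z| ≤ D) (p : ℂ[X]) :
    ‖polyEmbedding Ψ₁ hB₀ p‖ ^ 2 ≤
      Real.exp (2 * D) * ∫ z, ‖p.eval z‖ ^ 2 * Real.exp (-(B₀ / 2) * ‖z‖ ^ 2) := by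
  rw [norm_sq_eq_integral, ← integral_const_mul]
  refine integral_mono_ae (integrable_norm_sq _)
    ((integrable_norm_sq_polynomial hB₀ p).const_mul _) ?_
  filter_upwards [hΨ, polyEmbedding_ae (Ψ₁ := Ψ₁) hB₀ p] with z hz h
  rw [h, norm_sq_weighted]
  exact mul_le_mul_of_nonneg_right (exp_neg_two_mul_le hz) (by positivity)

theorem IsWeight.le_integral_polyEmbedding (hv : IsWeight v R) (hB₀ : 0 < B₀) {D : ℝ}
    (hΨ : ∀ᵐ z : ℂ, |Ψ₁ z| ≤ D) (p : ℂ[X]) :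
    Real.exp (-2 * D - B₀ / 2 * R ^ 2) * ∫ z, ‖p.eval z‖ ^ 2 * v z ≤
      ∫ z, v z * ‖polyEmbedding Ψ₁ hB₀ p z‖ ^ 2 := by
  have hpc := p.continuous
  rw [← integral_const_mul]
  refine integral_mono_ae
    ((hv.integrable_mul (g := fun z => ‖p.eval z‖ ^ 2) (by fun_prop)).const_mul _)
    (hv.integrable_mul_norm_sq hB₀.le hpc (polyEmbedding_ae hB₀ p)) ?_
  filter_upwards [hΨ, polyEmbedding_ae (Ψ₁ := Ψ₁) hB₀ p, hv.supp, hv.nonneg] with z hz h hs hn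
  by_cases hzR : R < ‖z‖
  · simp [hs hzR]
  · rw [not_lt] at hzR
    rw [h, norm_sq_weighted]
    calc Real.exp (-2 * D - B₀ / 2 * R ^ 2) * (‖p.eval z‖ ^ 2 * v z)
        ≤ (Real.exp (-2 * Ψ₁ z) * Real.exp (-(B₀ / 2) * ‖z‖ ^ 2)) * (‖p.eval z‖ ^ 2 * v z) := by
          rw [← Real.exp_add]
          gcongr
          have h1 := abs_le.1 hz
          have h2 : B₀ / 2 * ‖z‖ ^ 2 ≤ B₀ / 2 * R ^ 2 := by gcongr
          linarith
      _ = _ := by ring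

variable (Ψ₁) in
/-- The quadratic form of `P₀ v P₀` is bounded below on the polynomials of degree at most `n`. -/
theorem IsWeight.exists_lower_bound (hv : IsWeight v R) (hR : 0 < R) (hB₀ : 0 < B₀) :
    ∃ c : ℝ, 0 < c ∧ ∀ n : ℕ, ∀ u ∈ (Polynomial.degreeLT ℂ (n + 1)).map (polyEmbedding Ψ₁ hB₀),
      c * M n v / gaussMoment B₀ R n * ‖u‖ ^ 2 ≤ ∫ z, v z * ‖P0 B₀ Ψ₁ u z‖ ^ 2 := by
  obtain ⟨D, -, hΨ⟩ := exists_ae_abs_le Ψ₁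
  refine ⟨Real.exp (-2 * D - B₀ / 2 * R ^ 2) * Real.exp (-2 * D), by positivity, fun n u hu => ?_⟩
  obtain ⟨p, hp, rfl⟩ := hu
  rw [SetLike.mem_coe, Polynomial.mem_degreeLT] at hp
  have hdeg : p.natDegree ≤ n := by
    by_cases hp0 : p = 0
    · simp [hp0]
    · exact Nat.lt_succ_iff.1 ((Polynomial.natDegree_lt_iff_degree_lt hp0).2 hp)
  have hI := gaussMoment_pos hB₀ hR n
  have hM := hv.M_mul_integral_le hR hB₀ hdeg
  have hM0 : 0 ≤ M n v := le_M fun q _ _ => by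
    refine integral_nonneg_of_ae ?_
    filter_upwards [hv.nonneg] with z hz
    positivity
  rw [P0_polyEmbedding]
  refine le_trans ?_ (hv.le_integral_polyEmbedding hB₀ hΨ p)
  set E := Real.exp (-2 * D - B₀ / 2 * R ^ 2) with hE
  set X := ∫ z, ‖p.eval z‖ ^ 2 * Real.exp (-(B₀ / 2) * ‖z‖ ^ 2) with hX
  have hE2 : Real.exp (-2 * D) * Real.exp (2 * D) = 1 := by
    rw [← Real.exp_add]
    simp
  calc E * Real.exp (-2 * D) * M n v / gaussMoment B₀ R n * ‖polyEmbedding Ψ₁ hB₀ p‖ ^ 2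
      ≤ E * Real.exp (-2 * D) * M n v / gaussMoment B₀ R n * (Real.exp (2 * D) * X) := by
        gcongr
        exact norm_sq_polyEmbedding_le hB₀ hΨ p
    _ = E * (Real.exp (-2 * D) * Real.exp (2 * D)) * (M n v * X) / gaussMoment B₀ R n := by ring
    _ ≤ E * (Real.exp (-2 * D) * Real.exp (2 * D)) *
        (gaussMoment B₀ R n * ∫ z, ‖p.eval z‖ ^ 2 * v z) / gaussMoment B₀ R n := by gcongr
    _ = _ := by
        rw [hE2]
        field_simp

end Polynomials

/-! ### Asymptotics of `n`-th roots -/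

section Asymptotics

theorem factorial_le_stirling {n : ℕ} (hn : n ≠ 0) :
    (n.factorial : ℝ) ≤ Real.exp 1 * n * (n / Real.exp 1) ^ n := by
  obtain ⟨m, rfl⟩ := Nat.exists_eq_succ_of_ne_zero hn
  have h := Stirling.stirlingSeq'_antitone (Nat.zero_le m)
  simp only [Function.comp_apply, Nat.succ_eq_add_one, zero_add] at h
  rw [Stirling.stirlingSeq_one, Stirling.stirlingSeq, div_le_iff₀ (by positivity)] at h
  set x : ℝ := ((m + 1 : ℕ) : ℝ) with hx
  have hx1 : 1 ≤ x := by
    rw [hx]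
    push_cast
    linarith [(Nat.cast_nonneg m : (0 : ℝ) ≤ m)]
  have h2 : √(2 * x) ≤ √2 * x := by
    rw [Real.sqrt_mul (by norm_num)]
    gcongr
    exact Real.sqrt_le_iff.2 ⟨by linarith, by nlinarith⟩
  calc ((m + 1).factorial : ℝ) ≤ Real.exp 1 / √2 * (√(2 * x) * (x / Real.exp 1) ^ (m + 1)) := h
    _ ≤ Real.exp 1 / √2 * ((√2 * x) * (x / Real.exp 1) ^ (m + 1)) := by gcongr
    _ = _ := by field_simp

theorem tendsto_const_rpow_one_div {c : ℝ} (hc : 0 < c) :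
    Tendsto (fun n : ℕ => c ^ (1 / (n : ℝ))) atTop (𝓝 1) := by
  have h := (Real.continuousAt_const_rpow hc.ne' (b := 0)).tendsto.comp
    (tendsto_one_div_atTop_nhds_zero_nat (𝕜 := ℝ))
  rw [Real.rpow_zero] at h
  exact h

theorem tendsto_natCast_rpow_one_div :
    Tendsto (fun n : ℕ => (n : ℝ) ^ (1 / (n : ℝ))) atTop (𝓝 1) :=
  tendsto_rpow_div.comp tendsto_natCast_atTop_atTop

theorem pow_rpow_one_div {x : ℝ} (hx : 0 ≤ x) {n : ℕ} (hn : n ≠ 0) :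
    (x ^ n) ^ (1 / (n : ℝ)) = x := by
  rw [one_div]
  exact Real.pow_rpow_inv_natCast hx hn

/-- The upper bound optimized over the radius `ρ`, with `ρ² = n / (β x)`. -/
theorem eventually_factorial_mul_le {s M : ℕ → ℝ} (hM : ∀ n, 0 < M n) {β R C : ℝ}
    (hβ : 0 < β) (hC : 0 < C)
    (hU : ∀ n ρ, 2 * R < ρ →
      s n ≤ C * Real.exp (β * (ρ + 1) ^ 2) / ((ρ - 2 * R) ^ n) ^ 2 * M n) {x : ℝ} (hx : 1 < x) :
    ∃ K : ℝ, 0 < K ∧ ∀ᶠ n : ℕ in atTop, n.factorial * s n ≤ K * n * (β * x ^ 3) ^ n * M n := by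
  have hx0 : 0 < x := by linarith
  set τ := β * x with hτ
  have hτ0 : 0 < τ := by positivity
  have hτβ : 0 < τ - β := by
    rw [hτ]
    nlinarith
  refine ⟨C * Real.exp 1 * Real.exp (β * τ / (τ - β)), by positivity, ?_⟩
  have hρ : Tendsto (fun n : ℕ => √(n / τ)) atTop atTop :=
    Real.tendsto_sqrt_atTop.comp (tendsto_natCast_atTop_atTop.atTop_div_const hτ0)
  have hx1 : 0 < 1 - 1 / x := by
    have : 1 / x < 1 := (div_lt_one hx0).2 hx
    linarith
  filter_upwards [hρ.eventually_gt_atTop (2 * R / (1 - 1 / x)), hρ.eventually_gt_atTop (2 * R),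
    eventually_ne_atTop 0] with n h1 h2 hn
  have hn0 : (0 : ℝ) < n := by exact_mod_cast Nat.pos_of_ne_zero hn
  set ρ := √(n / τ) with hρdef
  have hρ2 : ρ ^ 2 = n / τ := Real.sq_sqrt (by positivity)
  have hρ0 : 0 < ρ := Real.sqrt_pos.2 (by positivity)
  have h3 : ρ / x ≤ ρ - 2 * R := by
    rw [div_lt_iff₀ hx1] at h1
    have : ρ * (1 - 1 / x) = ρ - ρ / x := by ring
    linarith
  have h4 : β * (ρ + 1) ^ 2 ≤ n + β * τ / (τ - β) := by
    have h5 : (n : ℝ) = τ * ρ ^ 2 := by rw [hρ2]; field_simp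
    have h6 : τ * ρ ^ 2 + β * τ / (τ - β) - β * (ρ + 1) ^ 2 =
        ((τ - β) * ρ - β) ^ 2 / (τ - β) := by
      field_simp
      ring
    have : 0 ≤ ((τ - β) * ρ - β) ^ 2 / (τ - β) := by positivity
    linarith
  have h7 : ((ρ / x) ^ n) ^ 2 = (n / (β * x ^ 3)) ^ n := by
    rw [← pow_mul, mul_comm n 2, pow_mul, div_pow, hρ2, hτ]
    congr 1
    field_simp
  have hMn := hM n
  have h8 : s n ≤ C * Real.exp (n + β * τ / (τ - β)) / (n / (β * x ^ 3)) ^ n * M n := by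
    refine (hU n ρ h2).trans ?_
    rw [← h7]
    gcongr
  calc n.factorial * s n
      ≤ (Real.exp 1 * n * (n / Real.exp 1) ^ n) *
        (C * Real.exp (n + β * τ / (τ - β)) / (n / (β * x ^ 3)) ^ n * M n) := by
        refine (mul_le_mul_of_nonneg_left h8 (by positivity)).trans ?_
        gcongr
        exact factorial_le_stirling hn
    _ = _ := by
        rw [Real.exp_add, div_pow, div_pow, ← Real.exp_nat_mul, mul_one]
        field_simp

/-- Two-sided bounds which are sharp up to factors of subexponential growth determine the
asymptotics of the `n`-th roots. -/
theorem exists_tendsto_zero_of_bounds {s M : ℕ → ℝ} (hs : ∀ n, 0 < s n) {β R C : ℝ}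
    (hβ : 0 < β) (hC : 0 < C)
    (hU : ∀ n ρ, 2 * R < ρ →
      s n ≤ C * Real.exp (β * (ρ + 1) ^ 2) / ((ρ - 2 * R) ^ n) ^ 2 * M n)
    (hL : ∀ t, 0 < t → t < β → ∃ c, 0 < c ∧ ∀ n, c * t ^ n * M n ≤ n.factorial * s n) :
    ∃ ε : ℕ → ℝ, Tendsto ε atTop (𝓝 0) ∧ ∀ n : ℕ, 1 ≤ n →
      ((n.factorial : ℝ) * s n) ^ (1 / (n : ℝ)) = β * M n ^ (1 / (n : ℝ)) * (1 + ε n) := by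
  have hM : ∀ n, 0 < M n := by
    intro n
    have h := (hs n).trans_le (hU n (2 * R + 1) (by linarith))
    refine pos_of_mul_pos_right h ?_
    positivity
  have hden : ∀ n : ℕ, 0 < β * M n ^ (1 / (n : ℝ)) := fun n =>
    mul_pos hβ (Real.rpow_pos_of_pos (hM n) _)
  have hnum : ∀ n : ℕ, 0 < (n.factorial : ℝ) * s n := fun n =>
    mul_pos (by exact_mod_cast n.factorial_pos) (hs n)
  refine ⟨fun n => ((n.factorial : ℝ) * s n) ^ (1 / (n : ℝ)) / (β * M n ^ (1 / (n : ℝ))) - 1, ?_,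
    fun n _ => ?_⟩
  swap
  · rw [add_sub_cancel]
    exact (div_mul_cancel₀ _ (hden n).ne').symm.trans (mul_comm _ _)
  rw [← sub_self (1 : ℝ)]
  refine Tendsto.sub_const ?_ 1
  rw [tendsto_order]
  constructor
  · intro a ha
    obtain ⟨b, hb1, hb2⟩ := exists_between (max_lt ha zero_lt_one)
    have hb0 : 0 < b := (le_max_right _ _).trans_lt hb1
    have hab : a < b := (le_max_left _ _).trans_lt hb1
    obtain ⟨c, hc, hcL⟩ := hL (β * b) (by positivity) (by nlinarith)
    have hlim := (tendsto_const_rpow_one_div hc).mul_const b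
    rw [one_mul] at hlim
    filter_upwards [hlim.eventually_const_lt hab, eventually_ne_atTop 0] with n h1 hn
    refine h1.trans_le ?_
    rw [le_div_iff₀ (hden n)]
    have h2 := Real.rpow_le_rpow (by have := hM n; positivity) (hcL n)
      (by positivity : 0 ≤ 1 / (n : ℝ))
    rw [Real.mul_rpow (by positivity) (hM n).le, Real.mul_rpow hc.le (by positivity),
      pow_rpow_one_div (by positivity) hn] at h2
    calc _ = c ^ (1 / (n : ℝ)) * (β * b) * M n ^ (1 / (n : ℝ)) := by ring
      _ ≤ _ := h2
  · intro b hb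
    obtain ⟨x, hxb, hx⟩ : ∃ x : ℝ, x ^ 3 < b ∧ 1 < x := by
      have h1 : ∀ᶠ x : ℝ in 𝓝[>] 1, x ^ 3 < b :=
        nhdsWithin_le_nhds ((continuous_pow 3).continuousAt.eventually_lt continuousAt_const
          (by simpa using hb))
      exact (h1.and self_mem_nhdsWithin).exists
    have hx0 : 0 < x := by linarith
    obtain ⟨K, hK, hev⟩ := eventually_factorial_mul_le hM hβ hC hU hx
    have hlim := ((tendsto_const_rpow_one_div hK).mul tendsto_natCast_rpow_one_div).mul_const
      (x ^ 3)
    rw [one_mul, one_mul] at hlim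
    filter_upwards [hev, hlim.eventually_lt_const hxb, eventually_ne_atTop 0] with n h1 h2 hn
    refine lt_of_le_of_lt ?_ h2
    rw [div_le_iff₀ (hden n)]
    have h3 := Real.rpow_le_rpow (hnum n).le h1 (by positivity : 0 ≤ 1 / (n : ℝ))
    rw [Real.mul_rpow (x := K * n * (β * x ^ 3) ^ n) (by positivity) (hM n).le,
      Real.mul_rpow (x := K * n) (by positivity) (by positivity),
      Real.mul_rpow hK.le (by positivity), pow_rpow_one_div (by positivity) hn] at h3
    refine h3.trans (le_of_eq ?_)
    ring

end Asymptotics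

/-! ### Eigenvalue asymptotics of `P₀ v P₀` -/

section Main

variable {v : ℂ → ℝ} {R : ℝ} {B₀ : ℝ} {Ψ₁ : Lp ℝ ∞ (volume : Measure ℂ)}

/-- The quadratic form of `P₀ v P₀` is arbitrarily small on subspaces of finite codimension, namely
on the functions `e^{-Ψ} z^n g` with large `n`. -/
theorem IsWeight.exists_codimLE_small (hv : IsWeight v R) (hR : 0 < R) (hB₀ : 0 ≤ B₀) {ε : ℝ}
    (hε : 0 < ε) : ∃ (n : ℕ) (W : Submodule ℂ L2), CodimLE W n ∧
      ∀ u ∈ W, ∫ z, v z * ‖P0 B₀ Ψ₁ u z‖ ^ 2 ≤ ε * ‖u‖ ^ 2 := by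
  obtain ⟨C, hC, hup⟩ := hv.exists_upper_bound Ψ₁ hR hB₀
  set X := C * Real.exp (B₀ / 2 * (4 * R + 1) ^ 2) * ∫ z, v z with hX
  have hI : 0 ≤ ∫ z, v z := integral_nonneg_of_ae hv.nonneg
  have hlim : Tendsto (fun n : ℕ => X * (1 / 4 : ℝ) ^ n) atTop (𝓝 0) := by
    simpa using (tendsto_pow_atTop_nhds_zero_of_lt_one (r := (1 / 4 : ℝ)) (by norm_num)
      (by norm_num)).const_mul X
  obtain ⟨n, hn⟩ := (hlim.eventually_lt_const hε).exists
  have hc := codimLE_divisibleBy (B₀ := B₀) (Ψ₁ := Ψ₁) (Multiset.replicate n 0)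
  rw [Multiset.card_replicate] at hc
  refine ⟨n, _, hc, fun u hu => ?_⟩
  have h1 := hup _ (fun a ha => by
    rw [Multiset.eq_of_mem_replicate ha, norm_zero]
    positivity) (4 * R) (by linarith) u hu
  refine h1.trans ?_
  have h2 : ∫ z, ‖(rootPoly (Multiset.replicate n 0)).eval z‖ ^ 2 * v z ≤
      (R ^ n) ^ 2 * ∫ z, v z := by
    rw [← integral_const_mul]
    refine hv.integral_mono (by fun_prop) (by fun_prop) fun z hz => ?_
    have : (rootPoly (Multiset.replicate n 0)).eval z = z ^ n := by simp [rootPoly]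
    rw [this, norm_pow]
    gcongr
  gcongr
  rw [Multiset.card_replicate]
  calc C * Real.exp (B₀ / 2 * (4 * R + 1) ^ 2) / ((4 * R - 2 * R) ^ n) ^ 2 *
        ∫ z, ‖(rootPoly (Multiset.replicate n 0)).eval z‖ ^ 2 * v z
      ≤ C * Real.exp (B₀ / 2 * (4 * R + 1) ^ 2) / ((4 * R - 2 * R) ^ n) ^ 2 *
        ((R ^ n) ^ 2 * ∫ z, v z) := by gcongr
    _ = X * (1 / 4 : ℝ) ^ n := by
        have h4 : 4 * R - 2 * R = 2 * R := by ring
        have h5 : (1 / 4 : ℝ) ^ n = 1 / (2 ^ n) ^ 2 := by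
          rw [← pow_mul, mul_comm n 2, pow_mul, div_pow, one_pow]
          norm_num
        rw [h4, h5, hX, mul_pow]
        field_simp
    _ ≤ ε := hn.le

end Main

end PauliOp

theorem lemma1 (B₀ : ℝ) (hB₀ : 0 < B₀) (Ψ₁ : Lp ℝ ∞ (volume : Measure ℂ))
    (v : ℂ → ℝ) (hv_int : Integrable v volume) (hv_nonneg : ∀ᵐ z : ℂ, 0 ≤ v z)
    (hv_supp : ∃ K : Set ℂ, IsCompact K ∧ ∀ᵐ z : ℂ, z ∉ K → v z = 0)
    (hv_ne : ¬ v =ᵐ[volume] 0) :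
    ∃ T : PauliOp.L2 →L[ℂ] PauliOp.L2,
      PauliOp.IsP0vP0 B₀ Ψ₁ v T ∧
      (∀ T' : PauliOp.L2 →L[ℂ] PauliOp.L2, PauliOp.IsP0vP0 B₀ Ψ₁ v T' → T' = T) ∧
      IsCompactOperator T ∧ IsSelfAdjoint T ∧
      (∃ s : ℕ → ℝ, PauliOp.IsEigenvalueSeq T s) ∧
      ∀ s : ℕ → ℝ, PauliOp.IsEigenvalueSeq T s →
        ∃ ε : ℕ → ℝ, Tendsto ε atTop (𝓝 0) ∧
          ∀ n : ℕ, 1 ≤ n →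
            ((n.factorial : ℝ) * s n) ^ (1 / (n : ℝ)) =
              B₀ / 2 * PauliOp.M n v ^ (1 / (n : ℝ)) * (1 + ε n) := by
  obtain ⟨K, hK, hvK⟩ := hv_supp
  obtain ⟨R, hR, hKR⟩ := hK.isBounded.subset_closedBall_lt 0 0
  have hv : PauliOp.IsWeight v R := ⟨hv_int, hv_nonneg, by
    filter_upwards [hvK] with z hz h
    exact hz fun hzK => absurd (hKR hzK) (by simpa using h)⟩
  obtain ⟨J, hJ, hT⟩ := hv.exists_isP0vP0 (Ψ₁ := Ψ₁) hB₀.le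
  set T := J.adjoint ∘L J with hTdef
  have hinner : ∀ u, (inner ℂ (T u) u).re = ∫ z, v z * ‖PauliOp.P0 B₀ Ψ₁ u z‖ ^ 2 := by
    intro u
    rw [← hJ, hTdef, ContinuousLinearMap.comp_apply, ContinuousLinearMap.adjoint_inner_left,
      inner_self_eq_norm_sq_to_K]
    norm_cast
  have hpos : ∀ u, 0 ≤ (inner ℂ (T u) u).re := fun u => by
    rw [hinner, ← hJ]
    positivity
  have hsa : IsSelfAdjoint T := by
    rw [hTdef, ContinuousLinearMap.isSelfAdjoint_iff', ContinuousLinearMap.adjoint_comp,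
      ContinuousLinearMap.adjoint_adjoint]
  have hsymm := hsa.isSymmetric
  have hJc : IsCompactOperator J := by
    refine PauliOp.isCompactOperator_of_codimLE J fun ε hε => ?_
    obtain ⟨n, W, hW, h⟩ := hv.exists_codimLE_small (Ψ₁ := Ψ₁) hR hB₀.le (pow_pos hε 2)
    refine ⟨n, W, hW, fun u hu => ?_⟩
    have := h u hu
    rw [← hJ, ← mul_pow] at this
    exact abs_le_of_sq_le_sq' this (by positivity) |>.2
  have hTc : IsCompactOperator T := hJc.clm_comp J.adjoint
  have hsmall : ∀ ε : ℝ, 0 < ε → ∃ (n : ℕ) (W : Submodule ℂ PauliOp.L2), PauliOp.CodimLE W n ∧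
      ∀ u ∈ W, (inner ℂ (T u) u).re ≤ ε * ‖u‖ ^ 2 := fun ε hε => by
    simp_rw [hinner]
    exact hv.exists_codimLE_small hR hB₀.le hε
  obtain ⟨C, hC, hup⟩ := hv.exists_upper_bound Ψ₁ hR hB₀.le
  obtain ⟨c, hc, hlow⟩ := hv.exists_lower_bound Ψ₁ hR hB₀
  have hlarge : ∀ n : ℕ, ∃ V : Submodule ℂ PauliOp.L2, Module.finrank ℂ V = n + 1 ∧
      ∀ u ∈ V, u ≠ 0 → 0 < (inner ℂ (T u) u).re := by
    intro n
    refine ⟨_, PauliOp.finrank_map_polyEmbedding (Ψ₁ := Ψ₁) hB₀ (n + 1), ?_⟩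
    rintro _ ⟨p, -, rfl⟩ hp
    obtain ⟨D, -, hΨ⟩ := PauliOp.exists_ae_abs_le Ψ₁
    rw [hinner, PauliOp.P0_polyEmbedding]
    refine lt_of_lt_of_le ?_ (hv.le_integral_polyEmbedding hB₀ hΨ p)
    refine mul_pos (Real.exp_pos _) (hv.integral_polynomial_pos hv_ne ?_)
    rintro rfl
    exact hp (map_zero _)
  refine ⟨T, hT, fun T' hT' => hT.unique hT', hTc, hsa,
    PauliOp.exists_isEigenvalueSeq hTc hsymm hpos hsmall hlarge, fun s hs => ?_⟩
  refine PauliOp.exists_tendsto_zero_of_bounds hs.pos (by positivity : 0 < B₀ / 2) hC (R := R)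
    (fun n ρ hρ => ?_) fun t ht htB => ?_
  · -- The infimum over `p` of the upper bounds given by the functions divisible by `p`.
    have hpow : 0 < (ρ - 2 * R) ^ n := pow_pos (by linarith) n
    set Q := C * Real.exp (B₀ / 2 * (ρ + 1) ^ 2) / ((ρ - 2 * R) ^ n) ^ 2 with hQ
    have hQ0 : 0 < Q := by positivity
    rw [← div_le_iff₀' hQ0]
    refine PauliOp.le_M fun p hp hpn => ?_
    rw [div_le_iff₀' hQ0]
    obtain ⟨S, hSc, hS, A, hA, hSA, -⟩ := PauliOp.exists_moved_roots hR p.roots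
    rw [PauliOp.card_roots_eq, hpn] at hSc
    have h1 : s n ≤ Q * ∫ z, ‖(PauliOp.rootPoly S).eval z‖ ^ 2 * v z := by
      have hcod := PauliOp.codimLE_divisibleBy (B₀ := B₀) (Ψ₁ := Ψ₁) S
      rw [hSc] at hcod
      refine hs.le_of_codimLE hsymm hcod fun u hu => ?_
      rw [hinner, hQ, ← hSc]
      exact hup S hS ρ hρ u hu
    refine h1.trans (mul_le_mul_of_nonneg_left ?_ hQ0.le)
    refine hv.integral_mono (by fun_prop) (by fun_prop) fun z hz => ?_
    have hpz : ‖p.eval z‖ = ‖(PauliOp.rootPoly p.roots).eval z‖ := by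
      conv_lhs => rw [PauliOp.eq_C_mul_rootPoly p, hp.leadingCoeff]
      simp
    rw [hpz]
    gcongr
    exact (le_mul_of_one_le_left (norm_nonneg _) hA).trans (hSA z hz)
  · obtain ⟨G, hG, hGn⟩ := PauliOp.exists_gaussMoment_le (R := R) ht htB
    refine ⟨c / G, by positivity, fun n => ?_⟩
    have h1 : c * PauliOp.M n v / PauliOp.gaussMoment B₀ R n ≤ s n := by
      refine hs.le_of_forall_mem_le hTc hsymm hpos
        (PauliOp.finrank_map_polyEmbedding (Ψ₁ := Ψ₁) hB₀ (n + 1)) fun u hu => ?_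
      rw [hinner]
      exact hlow n u hu
    have hg := PauliOp.gaussMoment_pos hB₀ hR n
    rw [div_le_iff₀ hg] at h1
    have hsn := hs.pos n
    have h2 : c * PauliOp.M n v ≤ s n * (n.factorial * (t ^ n)⁻¹ * G) :=
      h1.trans (by gcongr; exact hGn n)
    calc c / G * t ^ n * PauliOp.M n v = (c * PauliOp.M n v) * (t ^ n / G) := by ring
      _ ≤ (s n * (n.factorial * (t ^ n)⁻¹ * G)) * (t ^ n / G) := by gcongr
      _ = _ := by field_simp
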